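/- Let $n$ be a natural number, $J_n=\begin{pmatrix}0&-I_n\\ I_n&0\end{pmatrix}$, $\langle x,y\rangle=x^tJ_ny$ on $\mathbb R^{2n}$, $\mathrm{Sp}(n,\mathbb R)=\{g\in M_{2n}(\mathbb R)\mid g^tJ_ng=J_n\}$ and $\mathfrak{sp}(n,\mathbb R)=\{z\in M_{2n}(\mathbb R)\mid z^tJ_n+J_nz=0\}$. An element $X\in\mathfrak{sp}(n,\mathbb R)$ is *real* if $-X=gXg^{-1}$ for some $g\in\mathrm{Sp}(n,\mathbb R)$, and *strongly real* if $-X=\tau X\tau^{-1}$ for some $\tau\in\mathrm{Sp}(n,\mathbb R)$ with $\tau^2=I$. An element $u$ of $\mathrm{Sp}(n,\mathbb R)$ is *real* if it is conjugate to $u^{-1}$ in $\mathrm{Sp}(n,\mathbb R)$, and *strongly real* if $u=ab$ with $a,b\in\mathrm{Sp}(n,\mathbb R)$, $a^2=b^2=I$. A *signed Young diagram* of size $N$, up to permuting rows of equal length, is given by a partition $\mathbf d$ of $N$ (a part $d$ having multiplicity $t_d$) and integers $p_d,q_d\ge 0$ with $p_d+q_d=t_d$: the numbers of $+1$ and of $-1$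 in the first column of the block formed by the rows of length $d$. To a nilpotent $X\in\mathfrak{sp}(n,\mathbb R)$ one attaches a signed Young diagram of size $2n$ as follows. Choose an $\mathfrak{sl}_2$-triple $\{X,H,Y\}$ in $\mathfrak{sp}(n,\mathbb R)$, i.e. $[H,X]=2X$, $[H,Y]=-2Y$, $[X,Y]=H$ (with $H=Y=0$ if $X=0$). For $d\ge1$ let $M(d-1)$ be the sum of all $d$-dimensional irreducible submodules of $\mathbb R^{2n}$ for the span of $X,H,Y$, let $L(d-1)=M(d-1)\cap\ker Y$ and $t_d=\dim L(d-1)$; the integers $d$ with $t_d\neq0$ are the parts of $\mathbf d$, with multiplicities $t_d$. Choose bases $(v^d_j)_{1\le j\le t_d}$ of the spaces $L(d-1)$ such that the vectors $X^lv^d_j$ $(0\le l<d)$ form a basis of $\mathbb R^{2n}$ on which $\langle X^lv^d_j,X^{l'}v^{d'}_{j'}\rangle=0$ except possibly if $d=d'$, $l+l'=d-1$ and either $d$ is even and $j=j'$, or $d$ is odd and $|j-j'|=t_d/2$; and normalised so that $\langle v^d_j,X^{d-1}v^d_j\rangle=\pm1$ for $d$ even and $\langle v^d_j,X^{d-1}v^d_{j+t_d/2}\rangle=1$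 for $d$ odd and $j\le t_d/2$. For even $\eta$ put $p_\eta=\#\{j\mid\langle v^\eta_j,X^{\eta-1}v^\eta_j\rangle=1\}$ and $q_\eta=t_\eta-p_\eta$; for odd $d$ put $p_d=t_d$ and $q_d=0$. **Theorem.** (a) Let $X\in\mathfrak{sp}(n,\mathbb R)$ be nilpotent. The construction above can be carried out, and the signed Young diagram of $X$ does not depend on the choices made. The following are equivalent: 1. $X$ is real; 2. $X$ is strongly real; 3. $p_\eta=q_\eta$ for every even part $\eta$ of the signed Young diagram of $X$. (b) Let $u\in\mathrm{Sp}(n,\mathbb R)$ be unipotent. There is a unique nilpotent $X\in\mathfrak{sp}(n,\mathbb R)$ with $\exp X=u$, and the following are equivalent: $u$ is real; $u$ is strongly real; $p_\eta=q_\eta$ for every even part $\eta$ of the signed Young diagram of $X$. -/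

import Mathlib

open Matrix

noncomputable section

namespace SpReal

/-! ### Reality in a group -/

/-- `g` is real in the group `G`: it is conjugate to its inverse. -/
def IsRealElement {G : Type*} [Group G] (g : G) : Prop :=
  ∃ h : G, h * g * h⁻¹ = g⁻¹

/-- `g` is strongly real in `G`: it is a product of two elements of square one. -/
def IsStronglyRealElement {G : Type*} [Group G] (g : G) : Prop :=
  ∃ a b : G, a ^ 2 = 1 ∧ b ^ 2 = 1 ∧ g = a * b

/-! ### The symplectic group, its Lie algebra and the adjoint action -/

/-- The space `ℝ ^ (2 n)`, with coordinates indexed by `Fin n ⊕ Fin n`. -/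
abbrev Vec (n : ℕ) : Type := Fin n ⊕ Fin n → ℝ

/-- Real matrices of size `2 n`. -/
abbrev Mat (n : ℕ) : Type := Matrix (Fin n ⊕ Fin n) (Fin n ⊕ Fin n) ℝ

/-- The group `Sp(n, ℝ)`. -/
abbrev SpGroup (n : ℕ) : Type := Matrix.symplecticGroup (Fin n) ℝ

/-- The Lie algebra `sp(n, ℝ)`. -/
abbrev SpAlg (n : ℕ) : Type := LieAlgebra.Symplectic.sp (Fin n) ℝ

theorem conj_mem {n : ℕ} (g : SpGroup n) (X : SpAlg n) :
    (g : Mat n) * (X : Mat n) * ((g⁻¹ : SpGroup n) : Mat n)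
      ∈ LieAlgebra.Symplectic.sp (Fin n) ℝ := by
  have hX : (X : Mat n) ∈ skewAdjointMatricesLieSubalgebra (J (Fin n) ℝ) := X.2
  change _ ∈ skewAdjointMatricesLieSubalgebra (J (Fin n) ℝ)
  rw [mem_skewAdjointMatricesLieSubalgebra, mem_skewAdjointMatricesSubmodule] at hX ⊢
  simp only [Matrix.IsSkewAdjoint, Matrix.IsAdjointPair] at hX ⊢
  have hg : ((g⁻¹ : SpGroup n) : Mat n)ᵀ * J (Fin n) ℝ * ((g⁻¹ : SpGroup n) : Mat n)
      = J (Fin n) ℝ := SymplecticGroup.mem_iff'.1 (g⁻¹).2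
  have h1 : ((g⁻¹ : SpGroup n) : Mat n) * (g : Mat n) = 1 := by
    rw [← Submonoid.coe_mul, inv_mul_cancel, Submonoid.coe_one]
  have h2 : (g : Mat n) * ((g⁻¹ : SpGroup n) : Mat n) = 1 := by
    rw [← Submonoid.coe_mul, mul_inv_cancel, Submonoid.coe_one]
  have h3 : (g : Mat n)ᵀ * J (Fin n) ℝ = J (Fin n) ℝ * ((g⁻¹ : SpGroup n) : Mat n) := by
    calc (g : Mat n)ᵀ * J (Fin n) ℝ
        = (g : Mat n)ᵀ * J (Fin n) ℝ * ((g : Mat n) * ((g⁻¹ : SpGroup n) : Mat n)) := by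
          rw [h2, Matrix.mul_one]
      _ = ((g : Mat n)ᵀ * J (Fin n) ℝ * (g : Mat n)) * ((g⁻¹ : SpGroup n) : Mat n) := by
          simp only [Matrix.mul_assoc]
      _ = J (Fin n) ℝ * ((g⁻¹ : SpGroup n) : Mat n) := by
          rw [SymplecticGroup.mem_iff'.1 g.2]
  have h4 : ((g⁻¹ : SpGroup n) : Mat n)ᵀ * J (Fin n) ℝ = J (Fin n) ℝ * (g : Mat n) := by
    calc ((g⁻¹ : SpGroup n) : Mat n)ᵀ * J (Fin n) ℝ
        = ((g⁻¹ : SpGroup n) : Mat n)ᵀ * J (Fin n) ℝ *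
            (((g⁻¹ : SpGroup n) : Mat n) * (g : Mat n)) := by
          rw [h1, Matrix.mul_one]
      _ = J (Fin n) ℝ * (g : Mat n) := by
          rw [← Matrix.mul_assoc, hg]
  rw [Matrix.transpose_mul, Matrix.transpose_mul]
  calc ((g⁻¹ : SpGroup n) : Mat n)ᵀ * ((X : Mat n)ᵀ * (g : Mat n)ᵀ) * J (Fin n) ℝ
      = ((g⁻¹ : SpGroup n) : Mat n)ᵀ * ((X : Mat n)ᵀ * ((g : Mat n)ᵀ * J (Fin n) ℝ)) := by
        simp only [Matrix.mul_assoc]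
    _ = ((g⁻¹ : SpGroup n) : Mat n)ᵀ *
          (((X : Mat n)ᵀ * J (Fin n) ℝ) * ((g⁻¹ : SpGroup n) : Mat n)) := by
        rw [h3, Matrix.mul_assoc]
    _ = (((g⁻¹ : SpGroup n) : Mat n)ᵀ * J (Fin n) ℝ) *
          (-(X : Mat n)) * ((g⁻¹ : SpGroup n) : Mat n) := by
        rw [hX]; simp only [Matrix.mul_assoc]
    _ = J (Fin n) ℝ * -((g : Mat n) * (X : Mat n) * ((g⁻¹ : SpGroup n) : Mat n)) := by
        rw [h4]
        simp only [Matrix.mul_assoc, Matrix.mul_neg, Matrix.neg_mul]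

/-- The adjoint action `Ad(g) X = g X g⁻¹` of `Sp(n, ℝ)` on `sp(n, ℝ)`. -/
def Ad {n : ℕ} (g : SpGroup n) (X : SpAlg n) : SpAlg n :=
  ⟨(g : Mat n) * (X : Mat n) * ((g⁻¹ : SpGroup n) : Mat n), conj_mem g X⟩

/-- The adjoint orbit of `X`. -/
def adOrbit {n : ℕ} (X : SpAlg n) : Set (SpAlg n) :=
  Set.range fun g : SpGroup n => Ad g X

/-- `X` is (Ad-)real: `-X` lies in the adjoint orbit of `X`. -/
def IsAdReal {n : ℕ} (X : SpAlg n) : Prop :=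
  -X ∈ adOrbit X

/-- `X` is strongly (Ad-)real: `-X = Ad(τ) X` for some `τ` with `τ ^ 2 = 1`. -/
def IsStronglyAdReal {n : ℕ} (X : SpAlg n) : Prop :=
  ∃ τ : SpGroup n, τ ^ 2 = 1 ∧ -X = Ad τ X

/-- The symplectic form `⟨x, y⟩ = xᵗ J y` on `ℝ ^ (2 n)`. -/
def form {n : ℕ} (x y : Vec n) : ℝ :=
  x ⬝ᵥ (J (Fin n) ℝ *ᵥ y)

/-! ### `sl₂`-triples and isotypic components -/

/-- `{X, H, Y}` is an `sl₂`-triple through `X`; for `X = 0` the zero triple is used. -/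
def IsTriple {n : ℕ} (X H Y : SpAlg n) : Prop :=
  IsSl2Triple H X Y ∨ (X = 0 ∧ H = 0 ∧ Y = 0)

/-- `W` is stable under `X`, `H` and `Y`. -/
def IsStable {n : ℕ} (X H Y : SpAlg n) (W : Submodule ℝ (Vec n)) : Prop :=
  ∀ w ∈ W, (X : Mat n) *ᵥ w ∈ W ∧ (H : Mat n) *ᵥ w ∈ W ∧ (Y : Mat n) *ᵥ w ∈ W

/-- `W` is an irreducible submodule of `ℝ ^ (2 n)` for the span of `X`, `H`, `Y`. -/
def IsIrred {n : ℕ} (X H Y : SpAlg n) (W : Submodule ℝ (Vec n)) : Prop :=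
  W ≠ ⊥ ∧ IsStable X H Y W ∧
    ∀ U : Submodule ℝ (Vec n), U ≤ W → IsStable X H Y U → U = ⊥ ∨ U = W

/-- The isotypic component `M(d - 1)`: the sum of all irreducible submodules of dimension `d`. -/
def isotypic {n : ℕ} (X H Y : SpAlg n) (d : ℕ) : Submodule ℝ (Vec n) :=
  sSup {W | IsIrred X H Y W ∧ Module.finrank ℝ W = d}

/-- The space `L(d - 1) = ker Y ∩ M(d - 1)`. -/
def lowest {n : ℕ} (X H Y : SpAlg n) (d : ℕ) : Submodule ℝ (Vec n) :=
  LinearMap.ker (Matrix.mulVecLin (Y : Mat n)) ⊓ isotypic X H Y d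

/-! ### Signed Young diagrams -/

/-- A signed Young diagram with `N` boxes, up to permutation of rows of equal length. The signs of
the boxes of a row are determined by its leftmost box, so the diagram amounts to a partition of `N`
(the row lengths) and, for each `d`, the numbers `p d` of `+1` and `q d` of `-1` in the first
column of the block made of the rows of length `d`. -/
structure SignedYoungDiagram (N : ℕ) where
  shape : N.Partition
  p : ℕ → ℕ
  q : ℕ → ℕ
  p_add_q : ∀ d, p d + q d = shape.parts.count d

/-- The multiplicity `t_d` of the part `d`. -/
def SignedYoungDiagram.mult {N : ℕ} (D : SignedYoungDiagram N) (d : ℕ) : ℕ :=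
  D.shape.parts.count d

/-- `p_η = q_η` for every even part `η` of the diagram. -/
def SignedYoungDiagram.IsBalanced {N : ℕ} (D : SignedYoungDiagram N) : Prop :=
  ∀ η ∈ D.shape.parts, Even η → D.p η = D.q η

/-- For each `d`, the vectors `v d j` (`j < t d`) form a basis of `L(d - 1)`; the vectors
`X ^ l (v d j)` with `l < d` form bases of the `M(d - 1)` and together a basis of `ℝ ^ (2 n)` which
is adapted to the symplectic form and normalised. -/
structure IsAdaptedBasis {n : ℕ} (X H Y : SpAlg n) (t : ℕ → ℕ)
    (v : (d : ℕ) → Fin (t d) → Vec n) : Prop where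
  linearIndependent_lowest : ∀ d, LinearIndependent ℝ (v d)
  span_lowest : ∀ d, Submodule.span ℝ (Set.range (v d)) = lowest X H Y d
  pow_eq_zero : ∀ d (j : Fin (t d)), ((X : Mat n) ^ d) *ᵥ v d j = 0
  weight : ∀ d (j : Fin (t d)) (l : ℕ), l < d →
    (H : Mat n) *ᵥ (((X : Mat n) ^ l) *ᵥ v d j) =
      (2 * (l : ℝ) + 1 - (d : ℝ)) • (((X : Mat n) ^ l) *ᵥ v d j)
  span_isotypic : ∀ d, Submodule.span ℝ
    (Set.range fun i : Fin (t d) × Fin d => ((X : Mat n) ^ (i.2 : ℕ)) *ᵥ v d i.1) =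
      isotypic X H Y d
  linearIndependent : LinearIndependent ℝ
    (fun i : (d : ℕ) × (Fin (t d) × Fin d) => ((X : Mat n) ^ (i.2.2 : ℕ)) *ᵥ v i.1 i.2.1)
  span_eq_top : Submodule.span ℝ (Set.range
    (fun i : (d : ℕ) × (Fin (t d) × Fin d) => ((X : Mat n) ^ (i.2.2 : ℕ)) *ᵥ v i.1 i.2.1)) = ⊤
  orthogonal : ∀ d d' (j : Fin (t d)) (j' : Fin (t d')) (l l' : ℕ), l < d → l' < d' →
    form (((X : Mat n) ^ l) *ᵥ v d j) (((X : Mat n) ^ l') *ᵥ v d' j') ≠ 0 →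
      d = d' ∧ l + l' + 1 = d ∧
        ((Even d ∧ (j : ℕ) = j') ∨
          (Odd d ∧ ((j' : ℕ) = j + t d / 2 ∨ (j : ℕ) = j' + t d / 2)))
  norm_even : ∀ d, Even d → ∀ j : Fin (t d),
    form (v d j) (((X : Mat n) ^ (d - 1)) *ᵥ v d j) = 1 ∨
      form (v d j) (((X : Mat n) ^ (d - 1)) *ᵥ v d j) = -1
  norm_odd : ∀ d, Odd d → ∀ j j' : Fin (t d), (j' : ℕ) = j + t d / 2 →
    form (v d j) (((X : Mat n) ^ (d - 1)) *ᵥ v d j') = 1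

/-- `D` is the signed Young diagram attached to `X`: for some `sl₂`-triple through `X` and some
adapted basis, `t_d = dim L(d - 1)`, the number `p_d` for even `d` counts the `j` with
`⟨v d j, X ^ (d - 1) (v d j)⟩ = 1`, and the rows of odd length start with `+1`. -/
def IsDiagramOf {n : ℕ} (X : SpAlg n) (D : SignedYoungDiagram (2 * n)) : Prop :=
  ∃ H Y : SpAlg n, IsTriple X H Y ∧
    (∀ d, D.mult d = Module.finrank ℝ (lowest X H Y d)) ∧
    ∃ v : (d : ℕ) → Fin (D.mult d) → Vec n, IsAdaptedBasis X H Y D.mult v ∧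
      (∀ d, Even d → D.p d =
        Nat.card {j : Fin (D.mult d) // form (v d j) (((X : Mat n) ^ (d - 1)) *ᵥ v d j) = 1}) ∧
      (∀ d, Odd d → D.q d = 0)

end SpReal

end

/-! Since `X` is skew, the form `(x, y) ↦ ω x (X ^ (d - 1) y)` is symmetric for even `d` and
alternating for odd `d`. On `ker X ^ d` its radical contains `ker X ^ (d - 1)` and the part of
`range X` inside `ker X ^ d`; modulo these the bottoms of the chains of length `d` form a basis. For
even `d`, `(p_d, q_d)` is therefore the signature of a form determined by `X` alone. This gives
uniqueness of the diagram by Sylvester's argument: a definite subspace has dimension at most the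
number of rows of its sign, with equality attained (`finrank_le_of_definite`, `exists_definite`).

If `g X g⁻¹ = -X` with `g` symplectic, then for even `d` the map `g` changes the sign of this form,
because `d - 1` is odd; hence `p_d = q_d`. Conversely, if `p_d = q_d` for even `d`, pair the rows of
opposite sign by an involution `σ`, take `σ` to be the identity on rows of odd length, and send `X ^
l v_j` to `(-1) ^ l X ^ l v_(σ j)`. This map has square one and anticommutes with `X`. It is
symplectic: only `l + l' = d - 1` contributes, and there the sign `(-1) ^ (d - 1)` is cancelled by
the change of sign of the row when `d` is even, and is `1` when `d` is odd.

An adapted basis is built by splitting off, for decreasing `d`, a chain (`d` even) or a dual pair of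
isotropic chains (`d` odd) from a nondegenerate stable subspace. The usual `sl₂` formulas on the
chains define `H` and `Y`; the shape of the Gram matrix makes them skew, and coordinates in the
basis identify the isotypic components.

The unipotent case reduces to the nilpotent one because `exp` is a bijection from nilpotent to
unipotent matrices, compatible with conjugation and carrying `-X` to the inverse. The logarithm is
obtained as a polynomial by successive correction, and injectivity of `exp` shows that the logarithm
of a symplectic matrix is skew. -/

noncomputable section

namespace SpReal

/-! ### Skew endomorphisms of a symplectic space -/

section Skew

variable {V : Type*} [AddCommGroup V] [Module ℝ V]

/-- `X` is skew for the alternating form `ω`. -/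
structure IsSkewPair (ω : LinearMap.BilinForm ℝ V) (X : Module.End ℝ V) : Prop where
  alt : ω.IsAlt
  skew : ∀ x y, ω (X x) y = -ω x (X y)

namespace IsSkewPair

variable {ω : LinearMap.BilinForm ℝ V} {X : Module.End ℝ V} (h : IsSkewPair ω X)
include h

theorem swap (x y : V) : ω x y = -ω y x := by
  rw [h.alt.neg_eq]

theorem pow_left (k : ℕ) (x y : V) : ω ((X ^ k) x) y = (-1) ^ k * ω x ((X ^ k) y) := by
  induction k generalizing y with
  | zero => simp
  | succ k ih =>
    rw [pow_succ' X, Module.End.mul_apply, h.skew, ih, ← Module.End.mul_apply, ← pow_succ,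
      pow_succ', ← pow_succ' X]
    ring

theorem pow_pow (a b : ℕ) (x y : V) :
    ω ((X ^ a) x) ((X ^ b) y) = (-1) ^ a * ω x ((X ^ (a + b)) y) := by
  rw [h.pow_left, pow_add, Module.End.mul_apply]

/-- The source of the parity dichotomy: the form twisted by `X ^ l` is symmetric for odd `l` and
alternating for even `l`. -/
theorem pow_symm (l : ℕ) (x y : V) : ω y ((X ^ l) x) = (-1) ^ (l + 1) * ω x ((X ^ l) y) := by
  rw [h.swap, h.pow_left]
  ring

theorem pow_self_even {l : ℕ} (hl : Even l) (x : V) : ω x ((X ^ l) x) = 0 := by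
  have := h.pow_symm l x x
  rw [hl.add_one.neg_one_pow] at this
  linarith

end IsSkewPair

theorem pow_apply_eq_zero_of_le {X : Module.End ℝ V} {d l : ℕ} (hdl : d ≤ l) {x : V}
    (hx : (X ^ d) x = 0) : (X ^ l) x = 0 := by
  obtain ⟨k, rfl⟩ := Nat.exists_eq_add_of_le' hdl
  rw [pow_add, Module.End.mul_apply, hx, map_zero]

theorem pow_apply_mem {X : Module.End ℝ V} {U : Submodule ℝ V} (hU : ∀ x ∈ U, X x ∈ U) (l : ℕ)
    {x : V} (hx : x ∈ U) : (X ^ l) x ∈ U := by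
  induction l with
  | zero => simpa
  | succ l ih => rw [pow_succ', Module.End.mul_apply]; exact hU _ ih

/-- `U` is stable under `X`, and `ω` is nondegenerate on `U`. -/
structure IsNondegStable (ω : LinearMap.BilinForm ℝ V) (X : Module.End ℝ V)
    (U : Submodule ℝ V) : Prop where
  stable : ∀ x ∈ U, X x ∈ U
  nondeg : ∀ x ∈ U, (∀ y ∈ U, ω x y = 0) → x = 0

/-- The vectors of `U` orthogonal to all `X ^ l x`, `x ∈ S`. -/
def chainOrtho (ω : LinearMap.BilinForm ℝ V) (X : Module.End ℝ V) (U : Submodule ℝ V)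
    (S : Set V) : Submodule ℝ V where
  carrier := {u | u ∈ U ∧ ∀ x ∈ S, ∀ l, ω ((X ^ l) x) u = 0}
  add_mem' := fun ha hb => ⟨U.add_mem ha.1 hb.1, fun x hx l => by
    rw [map_add, ha.2 x hx l, hb.2 x hx l, add_zero]⟩
  zero_mem' := ⟨U.zero_mem, fun x _ l => by rw [map_zero]⟩
  smul_mem' := fun c u hu => ⟨U.smul_mem c hu.1, fun x hx l => by
    rw [map_smul, hu.2 x hx l, smul_zero]⟩

theorem mem_chainOrtho {ω : LinearMap.BilinForm ℝ V} {X : Module.End ℝ V} {U : Submodule ℝ V}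
    {S : Set V} {u : V} :
    u ∈ chainOrtho ω X U S ↔ u ∈ U ∧ ∀ x ∈ S, ∀ l, ω ((X ^ l) x) u = 0 := Iff.rfl

/-! ### Splitting off chains with a monomial Gram matrix -/

section Split

variable {ω : LinearMap.BilinForm ℝ V} {X : Module.End ℝ V} (h : IsSkewPair ω X)
  {U : Submodule ℝ V} (hU : IsNondegStable ω X U)
include h hU

/-- A stable nondegenerate subspace splits off the span of finitely many chains having a basis
in which the Gram matrix is monomial. -/
theorem split_chains {ι : Type*} [Fintype ι] (S : Set V) (b : ι → V) (σ : ι → ι)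
    (hb : ∀ i, ∃ x ∈ S, ∃ l, b i = (X ^ l) x)
    (hSb : ∀ x ∈ S, ∀ l, (X ^ l) x = 0 ∨ ∃ i, (X ^ l) x = b i)
    (hSU : S ⊆ U) (hσ : ∀ i, σ (σ i) = i)
    (h0 : ∀ i j, j ≠ σ i → ω (b i) (b j) = 0) (h1 : ∀ i, ω (b i) (b (σ i)) ≠ 0) :
    IsNondegStable ω X (chainOrtho ω X U S) ∧
      U ≤ chainOrtho ω X U S ⊔ Submodule.span ℝ (Set.range b) := by
  classical
  have hbU : ∀ i, b i ∈ U := fun i => by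
    obtain ⟨x, hx, l, hl⟩ := hb i
    rw [hl]; exact pow_apply_mem hU.stable l (hSU hx)
  have hle : U ≤ chainOrtho ω X U S ⊔ Submodule.span ℝ (Set.range b) := by
    intro u hu
    -- The projection of `u` to the span of the chains: the only basis vector pairing nontrivially
    -- with `b i` is `b (σ i)`, so it reads off the coefficient of `b i`.
    set s : V := ∑ i, (ω (b (σ i)) u / ω (b (σ i)) (b i)) • b i with hs
    have hsmem : s ∈ Submodule.span ℝ (Set.range b) :=
      Submodule.sum_mem _ fun i _ => Submodule.smul_mem _ _ (Submodule.subset_span ⟨i, rfl⟩)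
    have hsU : s ∈ U := Submodule.sum_mem _ fun i _ => Submodule.smul_mem _ _ (hbU i)
    have key : ∀ i, ω (b i) (u - s) = 0 := by
      intro i
      have : ω (b i) s = ω (b i) u := by
        rw [hs, map_sum, Finset.sum_eq_single (σ i)]
        · rw [map_smul, hσ, smul_eq_mul, div_mul_cancel₀ _ (h1 i)]
        · intro j _ hj
          rw [map_smul, h0 i j hj, smul_zero]
        · simp
      rw [map_sub, this, sub_self]
    rw [← sub_add_cancel u s]
    refine Submodule.add_mem_sup (mem_chainOrtho.2 ⟨U.sub_mem hu hsU, fun x hx l => ?_⟩) hsmem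
    rcases hSb x hx l with h' | ⟨i, h'⟩
    · rw [h', map_zero, LinearMap.zero_apply]
    · rw [h']; exact key i
  refine ⟨⟨fun u hu => ⟨hU.stable u hu.1, fun x hx l => ?_⟩, fun u hu hu' => ?_⟩, hle⟩
  · have := hu.2 x hx (l + 1)
    rw [pow_succ', Module.End.mul_apply, h.skew] at this
    linarith
  · refine hU.nondeg u hu.1 fun y hy => ?_
    obtain ⟨y₁, hy₁, y₂, hy₂, rfl⟩ := Submodule.mem_sup.1 (hle hy)
    rw [map_add, hu' y₁ hy₁, zero_add]
    have : Submodule.span ℝ (Set.range b) ≤ LinearMap.ker (ω u) := by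
      rw [Submodule.span_le]
      rintro _ ⟨i, rfl⟩
      obtain ⟨x, hx, l, hl⟩ := hb i
      rw [SetLike.mem_coe, LinearMap.mem_ker, h.swap, hl, hu.2 x hx l, neg_zero]
    exact this hy₂

end Split

/-! ### Chains of even length -/

section Even

variable {ω : LinearMap.BilinForm ℝ V} {X : Module.End ℝ V} (h : IsSkewPair ω X)
  {U : Submodule ℝ V} (hU : IsNondegStable ω X U) {d : ℕ}
include h hU

/-- The form twisted by `X ^ (d - 1)` is symmetric and nonzero on `U`, so it has an anisotropic
vector, which is rescaled to norm `±1`. Adding multiples of `X ^ (m + 1) v` then removes the lower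
pairings of `v` with its own chain, from the top degree down, without disturbing those already
settled. -/
theorem exists_even_vector (hd : Even d) (h0 : ∀ x ∈ U, (X ^ d) x = 0)
    (h1 : ∃ x ∈ U, (X ^ (d - 1)) x ≠ 0) :
    ∃ v ∈ U, (ω v ((X ^ (d - 1)) v) = 1 ∨ ω v ((X ^ (d - 1)) v) = -1) ∧
      ∀ l, l ≠ d - 1 → ω v ((X ^ l) v) = 0 := by
  have hd0 : 1 ≤ d := by
    rcases Nat.eq_zero_or_pos d with rfl | hd'
    · obtain ⟨x, hx, hx'⟩ := h1
      exact absurd (h0 x hx) hx'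
    · exact hd'
  have hodd : Odd (d - 1) := Nat.Even.sub_odd hd0 hd odd_one
  -- Polarisation: if all norms vanished, the symmetric form would vanish, contradicting
  -- nondegeneracy and `X ^ (d - 1) ≠ 0` on `U`.
  have e1 : ∃ v ∈ U, ω v ((X ^ (d - 1)) v) ≠ 0 := by
    by_contra! hcon
    obtain ⟨x, hx, hx'⟩ := h1
    refine hx' (hU.nondeg _ (pow_apply_mem hU.stable _ hx) fun y hy => ?_)
    have h2 := hcon (x + y) (U.add_mem hx hy)
    simp only [map_add, LinearMap.add_apply, hcon x hx, hcon y hy, zero_add, add_zero] at h2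
    rw [h.pow_symm (d - 1) x y, hodd.add_one.neg_one_pow] at h2
    rw [h.pow_left]
    have : ω x ((X ^ (d - 1)) y) = 0 := by linarith
    rw [this, mul_zero]
  have e2 : ∃ v ∈ U, ω v ((X ^ (d - 1)) v) = 1 ∨ ω v ((X ^ (d - 1)) v) = -1 := by
    obtain ⟨v, hv, hne⟩ := e1
    set a := ω v ((X ^ (d - 1)) v) with ha
    refine ⟨(√|a|)⁻¹ • v, U.smul_mem _ hv, ?_⟩
    have hs : √|a| * √|a| = |a| := Real.mul_self_sqrt (abs_nonneg a)
    have hpos : 0 < |a| := abs_pos.2 hne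
    have : ω ((√|a|)⁻¹ • v) ((X ^ (d - 1)) ((√|a|)⁻¹ • v)) = a / |a| := by
      rw [map_smul, map_smul, map_smul, LinearMap.smul_apply, ← ha, smul_eq_mul, smul_eq_mul,
        ← mul_assoc, ← mul_inv, hs, div_eq_inv_mul]
    rw [this]
    rcases lt_or_gt_of_ne hne with h' | h'
    · right; rw [abs_of_neg h', div_neg, div_self hne]
    · left; rw [abs_of_pos h', div_self hne]
  have e3 : ∀ m, ∃ v ∈ U, (ω v ((X ^ (d - 1)) v) = 1 ∨ ω v ((X ^ (d - 1)) v) = -1) ∧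
      ∀ l, l < d - 1 → d - 1 ≤ l + m → ω v ((X ^ l) v) = 0 := by
    intro m
    induction m with
    | zero =>
      obtain ⟨v, hv, hv'⟩ := e2
      exact ⟨v, hv, hv', fun l h1 h2 => absurd h1 (by omega)⟩
    | succ m ih =>
      obtain ⟨v, hv, hε, hz⟩ := ih
      by_cases hm : Even (m + 1)
      swap
      -- For odd `m + 1` the new exponent `l = d - 1 - (m + 1)` is even, so the pairing is zero
      -- already.
      · refine ⟨v, hv, hε, fun l hl hl' => ?_⟩
        by_cases hlm : d - 1 ≤ l + m
        · exact hz l hl hlm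
        · refine h.pow_self_even ?_ v
          have : l + (m + 1) = d - 1 := by omega
          rw [Nat.not_even_iff_odd] at hm
          have h3 : Odd (l + (m + 1)) := this ▸ hodd
          exact (Nat.odd_add'.1 h3).1 hm
      set ε := ω v ((X ^ (d - 1)) v) with hεd
      have hε0 : ε ≠ 0 := by rcases hε with h' | h' <;> rw [h'] <;> norm_num
      -- For even `m + 1` the two cross terms agree, so `c` solves `ω v (X ^ l v) + 2 c ε = 0` at `l
      -- = d - 1 - (m + 1)`; the quadratic term has exponent at least `d`.
      set c := -(ω v ((X ^ (d - 1 - (m + 1))) v)) / (2 * ε) with hc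
      have expand : ∀ l, ω (v + c • (X ^ (m + 1)) v) ((X ^ l) (v + c • (X ^ (m + 1)) v)) =
          ω v ((X ^ l) v) + 2 * c * ω v ((X ^ (l + (m + 1))) v) +
            c ^ 2 * ω v ((X ^ (l + 2 * (m + 1))) v) := by
        intro l
        have a1 : (X ^ l) ((X ^ (m + 1)) v) = (X ^ (l + (m + 1))) v := by
          rw [pow_add X l, Module.End.mul_apply]
        rw [map_add (X ^ l), map_smul (X ^ l), a1]
        simp only [map_add, LinearMap.add_apply, map_smul, LinearMap.smul_apply, smul_eq_mul,
          h.pow_pow, hm.neg_one_pow]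
        rw [show m + 1 + (l + (m + 1)) = l + 2 * (m + 1) by ring,
          show m + 1 + l = l + (m + 1) by ring]
        ring
      have big : ∀ l, d ≤ l → ω v ((X ^ l) v) = 0 := fun l hl => by
        rw [pow_apply_eq_zero_of_le hl (h0 v hv), map_zero]
      refine ⟨v + c • (X ^ (m + 1)) v,
        U.add_mem hv (U.smul_mem _ (pow_apply_mem hU.stable _ hv)), ?_, fun l hl hl' => ?_⟩
      · rw [expand, big (d - 1 + (m + 1)) (by omega), big (d - 1 + 2 * (m + 1)) (by omega)]
        simpa using hε
      · rw [expand, big (l + 2 * (m + 1)) (by omega)]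
        by_cases hlm : d - 1 ≤ l + m
        · rw [hz l hl hlm, big (l + (m + 1)) (by omega)]; ring
        · have e : l + (m + 1) = d - 1 := by omega
          have e' : l = d - 1 - (m + 1) := by omega
          rw [e, ← hεd, hc, ← e']
          field_simp
          ring
  obtain ⟨v, hv, hε, hz⟩ := e3 (d - 1)
  refine ⟨v, hv, hε, fun l hl => ?_⟩
  rcases lt_or_gt_of_ne hl with h' | h'
  · exact hz l h' (by omega)
  · rw [pow_apply_eq_zero_of_le (show d ≤ l by omega) (h0 v hv), map_zero]

/-- In even length, a chain splits off. -/
theorem split_even (hd : Even d) (h0 : ∀ x ∈ U, (X ^ d) x = 0)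
    (h1 : ∃ x ∈ U, (X ^ (d - 1)) x ≠ 0) :
    ∃ v ∈ U, (ω v ((X ^ (d - 1)) v) = 1 ∨ ω v ((X ^ (d - 1)) v) = -1) ∧
      (∀ l, l ≠ d - 1 → ω v ((X ^ l) v) = 0) ∧
      IsNondegStable ω X (chainOrtho ω X U {v}) ∧
      U ≤ chainOrtho ω X U {v} ⊔ Submodule.span ℝ (Set.range fun l : Fin d => (X ^ (l : ℕ)) v) := by
  obtain ⟨v, hv, hε, hz⟩ := exists_even_vector h hU hd h0 h1
  refine ⟨v, hv, hε, hz, ?_⟩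
  refine split_chains h hU {v} (fun l : Fin d => (X ^ (l : ℕ)) v) Fin.rev
    (fun i => ⟨v, rfl, i, rfl⟩) ?_ (by simpa using hv) Fin.rev_rev ?_ ?_
  · rintro x rfl l
    by_cases hl : l < d
    · exact Or.inr ⟨⟨l, hl⟩, rfl⟩
    · exact Or.inl (pow_apply_eq_zero_of_le (not_lt.1 hl) (h0 x hv))
  · intro i j hij
    rw [h.pow_pow, hz, mul_zero]
    intro hcon
    apply hij
    ext
    rw [Fin.val_rev]
    omega
  · intro i
    have : (i : ℕ) + (Fin.rev i : Fin d) = d - 1 := by rw [Fin.val_rev]; omega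
    rw [h.pow_pow, this]
    refine mul_ne_zero (by simp) ?_
    rcases hε with h' | h' <;> rw [h'] <;> norm_num

end Even

/-! ### Dual pairs of chains of odd length -/

section Odd

variable {ω : LinearMap.BilinForm ℝ V} {X : Module.End ℝ V} (h : IsSkewPair ω X)
  {U : Submodule ℝ V} (hU : IsNondegStable ω X U) {d : ℕ}
include h hU

/-- The form twisted by `X ^ (d - 1)` is now alternating and nonzero, so one starts from a pair with
pairing `1`. The corrections come in a definite order: `v` is made isotropic using `w`, then the
chain of `w` is made dual to that of `v`, then `w` is made isotropic using `v`. The last step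
preserves the pairings with `v` because `v` is already isotropic. -/
theorem exists_odd_pair (hd : Odd d) (h0 : ∀ x ∈ U, (X ^ d) x = 0)
    (h1 : ∃ x ∈ U, (X ^ (d - 1)) x ≠ 0) :
    ∃ v ∈ U, ∃ w ∈ U, (∀ l, ω v ((X ^ l) v) = 0) ∧ (∀ l, ω w ((X ^ l) w) = 0) ∧
      ω v ((X ^ (d - 1)) w) = 1 ∧ ∀ l, l ≠ d - 1 → ω v ((X ^ l) w) = 0 := by
  have hd0 : 1 ≤ d := hd.pos
  have heven : Even (d - 1) := Nat.Odd.sub_odd hd odd_one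
  have big : ∀ l, d ≤ l → ∀ x, ∀ y ∈ U, ω x ((X ^ l) y) = 0 := fun l hl x y hy => by
    rw [pow_apply_eq_zero_of_le hl (h0 y hy), map_zero]
  have e1 : ∃ v ∈ U, ∃ w ∈ U, ω v ((X ^ (d - 1)) w) = 1 := by
    by_contra! hcon
    obtain ⟨x, hx, hx'⟩ := h1
    refine hx' (hU.nondeg _ (pow_apply_mem hU.stable _ hx) fun y hy => ?_)
    by_contra hne
    rw [h.pow_left, heven.neg_one_pow, one_mul] at hne
    refine hcon x hx _ (U.smul_mem (ω x ((X ^ (d - 1)) y))⁻¹ hy) ?_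
    rw [map_smul, map_smul, smul_eq_mul, inv_mul_cancel₀ hne]
  -- make `v` isotropic
  have e2 : ∀ m, ∃ v ∈ U, ∃ w ∈ U, ω v ((X ^ (d - 1)) w) = 1 ∧
      ∀ l, d ≤ l + m → ω v ((X ^ l) v) = 0 := by
    intro m
    induction m with
    | zero =>
      obtain ⟨v, hv, w, hw, hvw⟩ := e1
      exact ⟨v, hv, w, hw, hvw, fun l hl => big l (by omega) v v hv⟩
    | succ m ih =>
      obtain ⟨v, hv, w, hw, hvw, hz⟩ := ih
      by_cases hm : Odd m
      swap
      · refine ⟨v, hv, w, hw, hvw, fun l hl => ?_⟩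
        by_cases hlm : d ≤ l + m
        · exact hz l hlm
        · refine h.pow_self_even ?_ v
          have e : l + m = d - 1 := by omega
          rw [Nat.not_odd_iff_even] at hm
          exact (Nat.even_add.1 (e ▸ heven)).2 hm
      have hm1 := hm.pos
      -- Here `l = d - 1 - m` is odd, so the two cross terms add up to `2 c`.
      set c := -(ω v ((X ^ (d - 1 - m)) v)) / 2 with hc
      have expand : ∀ l, ω (v + c • (X ^ m) w) ((X ^ l) (v + c • (X ^ m) w)) =
          ω v ((X ^ l) v) + c * ω v ((X ^ (l + m)) w) +
            -c * ((-1) ^ l * ω v ((X ^ (l + m)) w)) - c ^ 2 * ω w ((X ^ (l + 2 * m)) w) := by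
        intro l
        have a1 : (X ^ l) ((X ^ m) w) = (X ^ (l + m)) w := by
          rw [pow_add, Module.End.mul_apply]
        rw [map_add (X ^ l), map_smul (X ^ l), a1]
        simp only [map_add, LinearMap.add_apply, map_smul, LinearMap.smul_apply, smul_eq_mul,
          h.pow_pow, hm.neg_one_pow]
        rw [show m + (l + m) = l + 2 * m by ring, show m + l = l + m by ring,
          h.pow_symm (l + m) v w, pow_succ, pow_add (-1 : ℝ), hm.neg_one_pow]
        ring
      refine ⟨v + c • (X ^ m) w, U.add_mem hv (U.smul_mem _ (pow_apply_mem hU.stable _ hw)),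
        w, hw, ?_, fun l hl => ?_⟩
      · rw [map_add, LinearMap.add_apply, hvw, map_smul, LinearMap.smul_apply, h.pow_pow,
          big (m + (d - 1)) (by omega) _ w hw]
        simp
      · rw [expand, big (l + 2 * m) (by omega) _ w hw]
        by_cases hlm : d ≤ l + m
        · rw [hz l hlm, big (l + m) (by omega) _ w hw]; ring
        · have e : l + m = d - 1 := by omega
          have e' : l = d - 1 - m := by omega
          have hl2 : Even l ↔ Even m := Nat.even_add.1 (e ▸ heven)
          have hl3 : ¬ Even l := by rw [hl2, Nat.not_even_iff_odd]; exact hm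
          have hl4 : Odd l := Nat.not_even_iff_odd.1 hl3
          rw [hl4.neg_one_pow, e, hvw, hc, ← e']
          ring
  obtain ⟨v, hv, w₀, hw₀, hvw₀, hvv'⟩ := e2 d
  have hvv : ∀ l, ω v ((X ^ l) v) = 0 := fun l => hvv' l (by omega)
  -- Duality of the chains, from the top degree down: `X ^ (m + 1) w` pairs to `1` with `v` exactly
  -- in degree `d - 1 - (m + 1)`, and to `0` in the higher degrees.
  have e3 : ∀ m, ∃ w ∈ U, ω v ((X ^ (d - 1)) w) = 1 ∧
      ∀ l, l < d - 1 → d - 1 ≤ l + m → ω v ((X ^ l) w) = 0 := by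
    intro m
    induction m with
    | zero => exact ⟨w₀, hw₀, hvw₀, fun l h1 h2 => absurd h1 (by omega)⟩
    | succ m ih =>
      obtain ⟨w, hw, hvw, hz⟩ := ih
      set c := -(ω v ((X ^ (d - 1 - (m + 1))) w)) with hc
      have expand : ∀ l, ω v ((X ^ l) (w + c • (X ^ (m + 1)) w)) =
          ω v ((X ^ l) w) + c * ω v ((X ^ (l + (m + 1))) w) := by
        intro l
        rw [pow_add X l, Module.End.mul_apply, map_add, map_add, map_smul, map_smul, smul_eq_mul]
      refine ⟨w + c • (X ^ (m + 1)) w, U.add_mem hw (U.smul_mem _ (pow_apply_mem hU.stable _ hw)),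
        ?_, fun l hl hl' => ?_⟩
      · rw [expand, hvw, big (d - 1 + (m + 1)) (by omega) _ w hw]
        ring
      · rw [expand]
        by_cases hlm : d - 1 ≤ l + m
        · rw [hz l hl hlm, big (l + (m + 1)) (by omega) _ w hw]; ring
        · rw [show l + (m + 1) = d - 1 by omega, hvw, hc, show d - 1 - (m + 1) = l by omega]
          ring
  obtain ⟨w₁, hw₁, hvw₁, hz₁⟩ := e3 (d - 1)
  have e4 : ∀ m, ∃ w ∈ U, ω v ((X ^ (d - 1)) w) = 1 ∧
      (∀ l, l ≠ d - 1 → ω v ((X ^ l) w) = 0) ∧ ∀ l, d ≤ l + m → ω w ((X ^ l) w) = 0 := by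
    intro m
    induction m with
    | zero =>
      refine ⟨w₁, hw₁, hvw₁, fun l hl => ?_, fun l hl => big l (by omega) _ _ hw₁⟩
      rcases lt_or_gt_of_ne hl with h' | h'
      · exact hz₁ l h' (by omega)
      · exact big l (by omega) _ _ hw₁
    | succ m ih =>
      obtain ⟨w, hw, hvw, hne, hz⟩ := ih
      by_cases hm : Odd m
      swap
      · refine ⟨w, hw, hvw, hne, fun l hl => ?_⟩
        by_cases hlm : d ≤ l + m
        · exact hz l hlm
        · refine h.pow_self_even ?_ w
          have e : l + m = d - 1 := by omega
          rw [Nat.not_odd_iff_even] at hm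
          exact (Nat.even_add.1 (e ▸ heven)).2 hm
      -- The cross terms add up to `-2 c` this time, and there is no quadratic term since `v` is
      -- isotropic.
      set c := ω w ((X ^ (d - 1 - m)) w) / 2 with hc
      have expand : ∀ l, ω (w + c • (X ^ m) v) ((X ^ l) (w + c • (X ^ m) v)) =
          ω w ((X ^ l) w) + c * ((-1) ^ l * ω v ((X ^ (l + m)) w)) -
            c * ω v ((X ^ (l + m)) w) := by
        intro l
        have a1 : (X ^ l) ((X ^ m) v) = (X ^ (l + m)) v := by
          rw [pow_add, Module.End.mul_apply]
        rw [map_add (X ^ l), map_smul (X ^ l), a1]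
        simp only [map_add, LinearMap.add_apply, map_smul, LinearMap.smul_apply, smul_eq_mul,
          h.pow_pow, hm.neg_one_pow, hvv]
        rw [show m + l = l + m by ring,
          h.pow_symm (l + m) v w, pow_succ, pow_add (-1 : ℝ), hm.neg_one_pow]
        ring
      have same : ∀ l, ω v ((X ^ l) (w + c • (X ^ m) v)) = ω v ((X ^ l) w) := by
        intro l
        rw [map_add (X ^ l), map_smul (X ^ l), ← Module.End.mul_apply (X ^ l), ← pow_add, map_add,
          map_smul, hvv, smul_zero, add_zero]
      refine ⟨w + c • (X ^ m) v, U.add_mem hw (U.smul_mem _ (pow_apply_mem hU.stable _ hv)),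
        by rw [same, hvw], fun l hl => by rw [same, hne l hl], fun l hl => ?_⟩
      rw [expand]
      by_cases hlm : d ≤ l + m
      · rw [hz l hlm, big (l + m) (by omega) _ w hw]; ring
      · have e : l + m = d - 1 := by omega
        have hl2 : Even l ↔ Even m := Nat.even_add.1 (e ▸ heven)
        have hl3 : ¬ Even l := by rw [hl2, Nat.not_even_iff_odd]; exact hm
        rw [(Nat.not_even_iff_odd.1 hl3).neg_one_pow, e, hvw, hc, show d - 1 - m = l by omega]
        ring
  obtain ⟨w, hw, hvw, hne, hww⟩ := e4 d
  exact ⟨v, hv, w, hw, hvv, fun l => hww l (by omega), hvw, hne⟩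

/-- In odd length, a pair of chains splits off. -/
theorem split_odd (hd : Odd d) (h0 : ∀ x ∈ U, (X ^ d) x = 0)
    (h1 : ∃ x ∈ U, (X ^ (d - 1)) x ≠ 0) :
    ∃ v ∈ U, ∃ w ∈ U, (∀ l, ω v ((X ^ l) v) = 0) ∧ (∀ l, ω w ((X ^ l) w) = 0) ∧
      ω v ((X ^ (d - 1)) w) = 1 ∧ (∀ l, l ≠ d - 1 → ω v ((X ^ l) w) = 0) ∧
      IsNondegStable ω X (chainOrtho ω X U {v, w}) ∧
      U ≤ chainOrtho ω X U {v, w} ⊔ Submodule.span ℝ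
        (Set.range fun i : Fin d × Bool => (X ^ (i.1 : ℕ)) (if i.2 then w else v)) := by
  obtain ⟨v, hv, w, hw, hvv, hww, hvw, hne⟩ := exists_odd_pair h hU hd h0 h1
  refine ⟨v, hv, w, hw, hvv, hww, hvw, hne, ?_⟩
  have hne' : ∀ l, l ≠ d - 1 → ω w ((X ^ l) v) = 0 := fun l hl => by
    rw [h.pow_symm, hne l hl, mul_zero]
  have hwv : ω w ((X ^ (d - 1)) v) ≠ 0 := by
    rw [h.pow_symm, hvw]; simp
  refine split_chains h hU {v, w}
    -- The partner of `X ^ l v` is `X ^ (d - 1 - l) w`, and conversely: both the exponent and the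
    -- chain are exchanged.
    (fun i : Fin d × Bool => (X ^ (i.1 : ℕ)) (if i.2 then w else v)) (fun i => (i.1.rev, !i.2))
    ?_ ?_ ?_ ?_ ?_ ?_
  · rintro ⟨i, b⟩
    cases b
    · exact ⟨v, by simp, i, by simp⟩
    · exact ⟨w, by simp, i, by simp⟩
  · intro x hx l
    by_cases hl : l < d
    · rcases hx with rfl | rfl
      · exact Or.inr ⟨(⟨l, hl⟩, false), by simp⟩
      · exact Or.inr ⟨(⟨l, hl⟩, true), by simp⟩
    · refine Or.inl (pow_apply_eq_zero_of_le (not_lt.1 hl) (h0 x ?_))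
      rcases hx with rfl | rfl <;> assumption
  · rintro x (rfl | rfl) <;> assumption
  · rintro ⟨i, b⟩
    simp
  · rintro ⟨i, b⟩ ⟨j, b'⟩ hij
    have key : b' = !b → (i : ℕ) + j ≠ d - 1 := by
      intro hb hcon
      apply hij
      simp only [Prod.mk.injEq]
      refine ⟨?_, hb⟩
      ext
      rw [Fin.val_rev]
      omega
    rw [h.pow_pow]
    cases b <;> cases b'
    · simp [hvv]
    · simp [hne _ (key rfl)]
    · simp [hne' _ (key rfl)]
    · simp [hww]
  · rintro ⟨i, b⟩
    have : (i : ℕ) + (Fin.rev i : Fin d) = d - 1 := by rw [Fin.val_rev]; omega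
    rw [h.pow_pow, this]
    refine mul_ne_zero (by simp) ?_
    cases b
    · simp [hvw]
    · simpa using hwv

end Odd

end Skew

/-! ### All the chains of one given length -/

section Level

variable {V : Type*} [AddCommGroup V] [Module ℝ V]

/-- The chains of length `d` generated by `w j`, `j < s`, split off `U`, with complement `U'`
on which `X ^ (d - 1) = 0`. -/
structure IsLevel (ω : LinearMap.BilinForm ℝ V) (X : Module.End ℝ V) (U : Submodule ℝ V)
    (d s : ℕ) (w : ℕ → V) (U' : Submodule ℝ V) : Prop where
  le : U' ≤ U
  nondegStable : IsNondegStable ω X U'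
  pow_eq_zero : ∀ x ∈ U', (X ^ (d - 1)) x = 0
  mem : ∀ j < s, w j ∈ U
  ortho : ∀ j < s, ∀ u ∈ U', ∀ l, ω ((X ^ l) (w j)) u = 0
  even_card : Odd d → Even s
  gram : ∀ j < s, ∀ j' < s, ∀ l, ω (w j) ((X ^ l) (w j')) ≠ 0 →
    l + 1 = d ∧ ((Even d ∧ j = j') ∨ (Odd d ∧ (j' = j + s / 2 ∨ j = j' + s / 2)))
  norm_even : Even d → ∀ j < s,
    ω (w j) ((X ^ (d - 1)) (w j)) = 1 ∨ ω (w j) ((X ^ (d - 1)) (w j)) = -1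
  norm_odd : Odd d → ∀ j < s, ∀ j' < s, j' = j + s / 2 → ω (w j) ((X ^ (d - 1)) (w j')) = 1
  span : U ≤ U' ⊔ Submodule.span ℝ {x | ∃ j < s, ∃ l < d, x = (X ^ l) (w j)}

theorem chainOrtho_lt {ω : LinearMap.BilinForm ℝ V} {X : Module.End ℝ V} {U : Submodule ℝ V}
    {S : Set V} {x y : V} {l : ℕ} (hx : x ∈ S) (hy : y ∈ U) (hxy : ω ((X ^ l) x) y ≠ 0) :
    chainOrtho ω X U S < U := by
  refine lt_of_le_of_ne (fun _ hu => hu.1) fun he => hxy ?_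
  rw [← he] at hy
  exact hy.2 x hx l

variable {ω : LinearMap.BilinForm ℝ V} {X : Module.End ℝ V} (h : IsSkewPair ω X)
  [FiniteDimensional ℝ V] {d : ℕ}
include h

/-- One chain is removed at a time. The orthogonal complement is strictly smaller, so induction on a
bound for the dimension ends when `X ^ (d - 1)` vanishes on what is left. -/
theorem exists_level_even (hd : Even d) (N : ℕ) : ∀ U : Submodule ℝ V,
    Module.finrank ℝ U ≤ N → IsNondegStable ω X U → (∀ x ∈ U, (X ^ d) x = 0) →
      ∃ s w U', IsLevel ω X U d s w U' := by
  have hd' : ¬ Odd d := Nat.not_odd_iff_even.2 hd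
  have of_trivial : ∀ U : Submodule ℝ V, IsNondegStable ω X U → (∀ x ∈ U, (X ^ (d - 1)) x = 0) →
      ∃ s w U', IsLevel ω X U d s w U' := fun U hU hcon =>
    ⟨0, fun _ => 0, U, ⟨le_rfl, hU, hcon, by simp, by simp, by simp, by simp, by simp, by simp,
      le_sup_left⟩⟩
  induction N with
  | zero =>
    intro U hN hU _
    refine of_trivial U hU fun x hx => ?_
    have : U = ⊥ := Submodule.finrank_eq_zero.1 (Nat.le_zero.1 hN)
    rw [this, Submodule.mem_bot] at hx
    rw [hx, map_zero]
  | succ N ih =>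
    intro U hN hU h0
    by_cases hcon : ∀ x ∈ U, (X ^ (d - 1)) x = 0
    · exact of_trivial U hU hcon
    push Not at hcon
    obtain ⟨v, hv, hε, hz, hU₁, hle⟩ := split_even h hU hd h0 hcon
    have hlt : chainOrtho ω X U {v} < U := by
      refine chainOrtho_lt (x := v) (y := v) (l := d - 1) rfl hv ?_
      rw [h.swap]
      rcases hε with h' | h' <;> rw [h'] <;> norm_num
    obtain ⟨s, w, U', hL⟩ := ih _
      (Nat.le_of_lt_succ ((Submodule.finrank_lt_finrank_of_lt hlt).trans_le hN)) hU₁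
      fun x hx => h0 x hx.1
    have hvw : ∀ j < s, ∀ l, ω v ((X ^ l) (w j)) = 0 := fun j hj l => by
      simpa using (pow_apply_mem hU₁.stable l (hL.mem j hj)).2 v rfl 0
    have hwv : ∀ j < s, ∀ l, ω (w j) ((X ^ l) v) = 0 := fun j hj l => by
      rw [h.pow_symm, hvw j hj, mul_zero]
    refine ⟨s + 1, fun j => Nat.casesOn j v w, U', ⟨hL.le.trans hlt.le, hL.nondegStable,
      hL.pow_eq_zero, ?_, ?_, fun h' => absurd h' hd', ?_, ?_, fun h' => absurd h' hd', ?_⟩⟩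
    · rintro (_ | j) hj
      · exact hv
      · exact hlt.le (hL.mem j (by omega))
    · rintro (_ | j) hj
      · exact fun u hu l => (hL.le hu).2 v rfl l
      · exact hL.ortho j (by omega)
    · rintro (_ | j) hj (_ | j') hj' l hne
      · refine ⟨?_, Or.inl ⟨hd, rfl⟩⟩
        by_contra hl
        have hd0 : d ≠ 0 := by
          rintro rfl
          apply hne
          have := h0 v hv
          simp only [pow_zero, Module.End.one_apply] at this
          simp [this]
        exact hne (hz l (by omega))
      · exact absurd (hvw j' (by omega) l) hne
      · exact absurd (hwv j (by omega) l) hne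
      · obtain ⟨h1, h2⟩ := hL.gram j (by omega) j' (by omega) l hne
        refine ⟨h1, Or.inl ⟨hd, ?_⟩⟩
        rcases h2 with h2 | h2
        · rw [h2.2]
        · exact absurd h2.1 hd'
    · rintro - (_ | j) hj
      · exact hε
      · exact hL.norm_even hd j (by omega)
    · refine hle.trans (sup_le (hL.span.trans (sup_le_sup_left (Submodule.span_mono ?_) _)) ?_)
      · rintro _ ⟨j, hj, l, hl, rfl⟩
        exact ⟨j + 1, by omega, l, hl, rfl⟩
      · refine le_sup_of_le_right (Submodule.span_mono ?_)
        rintro _ ⟨l, rfl⟩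
        exact ⟨0, by omega, l, l.2, rfl⟩

/-- The two halves of the pairs are kept as separate sequences `a` and `b`: in a single list the
partner sits at distance half the length, which would change at every induction step. -/
theorem exists_level_odd_pairs (hd : Odd d) (N : ℕ) : ∀ U : Submodule ℝ V,
    Module.finrank ℝ U ≤ N → IsNondegStable ω X U → (∀ x ∈ U, (X ^ d) x = 0) →
      ∃ (s : ℕ) (a b : ℕ → V) (U' : Submodule ℝ V), U' ≤ U ∧ IsNondegStable ω X U' ∧
        (∀ x ∈ U', (X ^ (d - 1)) x = 0) ∧ (∀ j < s, a j ∈ U ∧ b j ∈ U) ∧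
        (∀ j < s, ∀ u ∈ U', ∀ l, ω ((X ^ l) (a j)) u = 0 ∧ ω ((X ^ l) (b j)) u = 0) ∧
        (∀ j < s, ∀ j' < s, ∀ l, ω (a j) ((X ^ l) (a j')) = 0 ∧ ω (b j) ((X ^ l) (b j')) = 0 ∧
          (ω (a j) ((X ^ l) (b j')) ≠ 0 → l + 1 = d ∧ j = j')) ∧
        (∀ j < s, ω (a j) ((X ^ (d - 1)) (b j)) = 1) ∧
        U ≤ U' ⊔ Submodule.span ℝ {x | ∃ j < s, ∃ l < d, x = (X ^ l) (a j) ∨ x = (X ^ l) (b j)} := by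
  have of_trivial : ∀ U : Submodule ℝ V, IsNondegStable ω X U → (∀ x ∈ U, (X ^ (d - 1)) x = 0) →
      ∃ (s : ℕ) (a b : ℕ → V) (U' : Submodule ℝ V), U' ≤ U ∧ IsNondegStable ω X U' ∧
        (∀ x ∈ U', (X ^ (d - 1)) x = 0) ∧ (∀ j < s, a j ∈ U ∧ b j ∈ U) ∧
        (∀ j < s, ∀ u ∈ U', ∀ l, ω ((X ^ l) (a j)) u = 0 ∧ ω ((X ^ l) (b j)) u = 0) ∧
        (∀ j < s, ∀ j' < s, ∀ l, ω (a j) ((X ^ l) (a j')) = 0 ∧ ω (b j) ((X ^ l) (b j')) = 0 ∧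
          (ω (a j) ((X ^ l) (b j')) ≠ 0 → l + 1 = d ∧ j = j')) ∧
        (∀ j < s, ω (a j) ((X ^ (d - 1)) (b j)) = 1) ∧
        U ≤ U' ⊔ Submodule.span ℝ {x | ∃ j < s, ∃ l < d, x = (X ^ l) (a j) ∨ x = (X ^ l) (b j)} :=
    fun U hU hcon => ⟨0, fun _ => 0, fun _ => 0, U, le_rfl, hU, hcon, by simp, by simp, by simp,
      by simp, le_sup_left⟩
  induction N with
  | zero =>
    intro U hN hU _
    refine of_trivial U hU fun x hx => ?_
    have : U = ⊥ := Submodule.finrank_eq_zero.1 (Nat.le_zero.1 hN)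
    rw [this, Submodule.mem_bot] at hx
    rw [hx, map_zero]
  | succ N ih =>
    intro U hN hU h0
    by_cases hcon : ∀ x ∈ U, (X ^ (d - 1)) x = 0
    · exact of_trivial U hU hcon
    push Not at hcon
    obtain ⟨v, hv, w, hw, hvv, hww, hvw, hne, hU₁, hle⟩ := split_odd h hU hd h0 hcon
    have hlt : chainOrtho ω X U {v, w} < U := by
      refine chainOrtho_lt (x := w) (y := v) (l := d - 1) (by simp) hv ?_
      rw [h.swap, hvw]; norm_num
    obtain ⟨s, a, b, U', hU'U, hU', hp, hm, ho, hg, hn, hs⟩ := ih _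
      (Nat.le_of_lt_succ ((Submodule.finrank_lt_finrank_of_lt hlt).trans_le hN)) hU₁
      fun x hx => h0 x hx.1
    have hvx : ∀ x ∈ chainOrtho ω X U {v, w}, ∀ l, ω v ((X ^ l) x) = 0 ∧ ω w ((X ^ l) x) = 0 :=
      fun x hx l => by
        have := (pow_apply_mem hU₁.stable l hx).2
        exact ⟨by simpa using this v (by simp) 0, by simpa using this w (by simp) 0⟩
    have hxv : ∀ x ∈ chainOrtho ω X U {v, w}, ∀ l, ω x ((X ^ l) v) = 0 ∧ ω x ((X ^ l) w) = 0 :=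
      fun x hx l => by
        rw [h.pow_symm, h.pow_symm l w x, (hvx x hx l).1, (hvx x hx l).2]
        simp
    refine ⟨s + 1, fun j => Nat.casesOn j v a, fun j => Nat.casesOn j w b, U', hU'U.trans hlt.le,
      hU', hp, ?_, ?_, ?_, ?_, ?_⟩
    · rintro (_ | j) hj
      · exact ⟨hv, hw⟩
      · exact ⟨hlt.le (hm j (by omega)).1, hlt.le (hm j (by omega)).2⟩
    · rintro (_ | j) hj
      · exact fun u hu l => ⟨(hU'U hu).2 v (by simp) l, (hU'U hu).2 w (by simp) l⟩
      · exact ho j (by omega)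
    · rintro (_ | j) hj (_ | j') hj' l
      · refine ⟨hvv l, hww l, fun hl => ⟨?_, rfl⟩⟩
        by_contra hl'
        have := hd.pos
        exact hl (hne l (by omega))
      · have hj'' := hm j' (by omega)
        exact ⟨(hvx _ hj''.1 l).1, (hvx _ hj''.2 l).2, fun hl => absurd (hvx _ hj''.2 l).1 hl⟩
      · have hj'' := hm j (by omega)
        exact ⟨(hxv _ hj''.1 l).1, (hxv _ hj''.2 l).2, fun hl => absurd (hxv _ hj''.1 l).2 hl⟩
      · have := hg j (by omega) j' (by omega) l
        exact ⟨this.1, this.2.1, fun hl => ⟨(this.2.2 hl).1, by rw [(this.2.2 hl).2]⟩⟩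
    · rintro (_ | j) hj
      · exact hvw
      · exact hn j (by omega)
    · refine hle.trans (sup_le (hs.trans (sup_le_sup_left (Submodule.span_mono ?_) _)) ?_)
      · rintro _ ⟨j, hj, l, hl, hx⟩
        exact ⟨j + 1, by omega, l, hl, hx⟩
      · refine le_sup_of_le_right (Submodule.span_mono ?_)
        rintro _ ⟨⟨l, c⟩, rfl⟩
        refine ⟨0, by omega, l, l.2, ?_⟩
        cases c
        · exact Or.inl rfl
        · exact Or.inr rfl

/-- Listing all of `a` and then all of `b` puts the partner of index `j < s` at `j + s`, half the
total length away, as the normal form requires. -/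
theorem exists_level_odd (hd : Odd d) (U : Submodule ℝ V) (hU : IsNondegStable ω X U)
    (h0 : ∀ x ∈ U, (X ^ d) x = 0) : ∃ s w U', IsLevel ω X U d s w U' := by
  obtain ⟨s, a, b, U', hU'U, hU', hp, hm, ho, hg, hn, hs⟩ :=
    exists_level_odd_pairs h hd _ U le_rfl hU h0
  have hd' : ¬ Even d := Nat.not_even_iff_odd.2 hd
  have hs2 : (s + s) / 2 = s := by omega
  refine ⟨s + s, fun j => if j < s then a j else b (j - s), U', ⟨hU'U, hU', hp, ?_, ?_,
    fun _ => ⟨s, rfl⟩, ?_, fun h' => absurd h' hd', ?_, ?_⟩⟩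
  · intro j hj
    split_ifs with hjs
    · exact (hm j hjs).1
    · exact (hm (j - s) (by omega)).2
  · intro j hj u hu l
    split_ifs with hjs
    · exact (ho j hjs u hu l).1
    · exact (ho (j - s) (by omega) u hu l).2
  · intro j hj j' hj' l
    rw [hs2]
    split_ifs with hjs hjs' hjs'
    · exact fun hl => absurd (hg j hjs j' hjs' l).1 hl
    · intro hl
      obtain ⟨h1, h2⟩ := (hg j hjs (j' - s) (by omega) l).2.2 hl
      exact ⟨h1, Or.inr ⟨hd, by omega⟩⟩
    · intro hl
      rw [h.pow_symm] at hl
      obtain ⟨h1, h2⟩ := (hg j' hjs' (j - s) (by omega) l).2.2 (right_ne_zero_of_mul hl)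
      exact ⟨h1, Or.inr ⟨hd, by omega⟩⟩
    · exact fun hl => absurd (hg (j - s) (by omega) (j' - s) (by omega) l).2.1 hl
  · intro _ j hj j' hj' hjj
    rw [hs2] at hjj
    have hjs : j < s := by omega
    rw [if_pos hjs, if_neg (by omega : ¬ j' < s), show j' - s = j by omega]
    exact hn j hjs
  · refine hs.trans (sup_le_sup_left (Submodule.span_mono ?_) _)
    rintro x ⟨j, hj, l, hl, rfl | rfl⟩
    · exact ⟨j, by omega, l, hl, by simp [hj]⟩
    · exact ⟨j + s, by omega, l, hl, by simp⟩

theorem exists_level (U : Submodule ℝ V) (hU : IsNondegStable ω X U)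
    (h0 : ∀ x ∈ U, (X ^ d) x = 0) : ∃ s w U', IsLevel ω X U d s w U' := by
  rcases Nat.even_or_odd d with hd | hd
  · exact exists_level_even h hd _ U le_rfl hU h0
  · exact exists_level_odd h hd U hU h0

end Level

/-! ### Chains of all lengths -/

section Chains

variable {V : Type*} [AddCommGroup V] [Module ℝ V]

/-- The vectors `X ^ l (v d j)`, `j < t d`, `l < d`, span `U`, and their Gram matrix is in
normal form. -/
structure IsChainSystem (ω : LinearMap.BilinForm ℝ V) (X : Module.End ℝ V) (U : Submodule ℝ V)
    (t : ℕ → ℕ) (v : ℕ → ℕ → V) : Prop where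
  zero : t 0 = 0
  mem : ∀ d, ∀ j < t d, v d j ∈ U
  pow_eq_zero : ∀ d, ∀ j < t d, (X ^ d) (v d j) = 0
  even_card : ∀ d, Odd d → Even (t d)
  gram : ∀ d d', ∀ j < t d, ∀ j' < t d', ∀ l, ω (v d j) ((X ^ l) (v d' j')) ≠ 0 →
    d = d' ∧ l + 1 = d ∧
      ((Even d ∧ j = j') ∨ (Odd d ∧ (j' = j + t d / 2 ∨ j = j' + t d / 2)))
  norm_even : ∀ d, Even d → ∀ j < t d,
    ω (v d j) ((X ^ (d - 1)) (v d j)) = 1 ∨ ω (v d j) ((X ^ (d - 1)) (v d j)) = -1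
  norm_odd : ∀ d, Odd d → ∀ j < t d, ∀ j' < t d, j' = j + t d / 2 →
    ω (v d j) ((X ^ (d - 1)) (v d j')) = 1
  span : U ≤ Submodule.span ℝ {x | ∃ d, ∃ j < t d, ∃ l < d, x = (X ^ l) (v d j)}

variable {ω : LinearMap.BilinForm ℝ V} {X : Module.End ℝ V} (h : IsSkewPair ω X)
  [FiniteDimensional ℝ V]
include h

/-- Descending through the lengths: once the chains of length `d + 1` are split off, `X ^ d`
vanishes on the complement and the induction hypothesis applies there. Orthogonality of the
complement to these chains makes chains of different lengths orthogonal. -/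
theorem exists_chainSystem (d : ℕ) : ∀ U : Submodule ℝ V, IsNondegStable ω X U →
    (∀ x ∈ U, (X ^ d) x = 0) →
      ∃ t v, IsChainSystem ω X U t v ∧ ∀ k, d < k → t k = 0 := by
  induction d with
  | zero =>
    intro U hU h0
    refine ⟨fun _ => 0, fun _ _ => 0, ⟨rfl, by simp, by simp, by simp, by simp, by simp, by simp,
      fun x hx => ?_⟩, by simp⟩
    have : x = 0 := by simpa using h0 x hx
    rw [this]
    exact Submodule.zero_mem _
  | succ d ih =>
    intro U hU h0
    obtain ⟨s, w, U', hL⟩ := exists_level h U hU h0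
    obtain ⟨t, v, hC, ht⟩ := ih U' hL.nondegStable (by simpa using hL.pow_eq_zero)
    have hk : ∀ {k j}, j < t k → k ≠ d + 1 := by
      rintro k j hj rfl
      rw [ht _ (Nat.lt_succ_self d)] at hj
      exact absurd hj (Nat.not_lt_zero _)
    have hwv : ∀ j < s, ∀ k, ∀ j' < t k, ∀ l, ω (w j) ((X ^ l) (v k j')) = 0 :=
      fun j hj k j' hj' l => by
        simpa using hL.ortho j hj _ (pow_apply_mem hL.nondegStable.stable l (hC.mem k j' hj')) 0
    refine ⟨Function.update t (d + 1) s, Function.update v (d + 1) w,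
      ⟨?_, fun k => ?_, fun k => ?_, fun k => ?_, fun k k' => ?_, fun k => ?_, fun k => ?_, ?_⟩,
      fun k hk => ?_⟩
    · rw [Function.update_of_ne (Nat.succ_ne_zero d).symm, hC.zero]
    · rcases eq_or_ne k (d + 1) with rfl | hkd
      · simp only [Function.update_self]; exact hL.mem
      · simp only [Function.update_of_ne hkd]; exact fun j hj => hL.le (hC.mem k j hj)
    · rcases eq_or_ne k (d + 1) with rfl | hkd
      · simp only [Function.update_self]; exact fun j hj => h0 _ (hL.mem j hj)
      · simp only [Function.update_of_ne hkd]; exact hC.pow_eq_zero k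
    · rcases eq_or_ne k (d + 1) with rfl | hkd
      · simp only [Function.update_self]; exact hL.even_card
      · simp only [Function.update_of_ne hkd]; exact hC.even_card k
    · rcases eq_or_ne k (d + 1) with rfl | hkd <;> rcases eq_or_ne k' (d + 1) with rfl | hkd'
      · simp only [Function.update_self]
        exact fun j hj j' hj' l hl => ⟨trivial, hL.gram j hj j' hj' l hl⟩
      · simp only [Function.update_self, Function.update_of_ne hkd']
        exact fun j hj j' hj' l hl => absurd (hwv j hj k' j' hj' l) hl
      · simp only [Function.update_self, Function.update_of_ne hkd]
        intro j hj j' hj' l hl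
        rw [h.pow_symm, hwv j' hj' k j hj l, mul_zero] at hl
        exact absurd rfl hl
      · simp only [Function.update_of_ne hkd, Function.update_of_ne hkd']
        exact hC.gram k k'
    · rcases eq_or_ne k (d + 1) with rfl | hkd
      · simp only [Function.update_self]; exact hL.norm_even
      · simp only [Function.update_of_ne hkd]; exact hC.norm_even k
    · rcases eq_or_ne k (d + 1) with rfl | hkd
      · simp only [Function.update_self]; exact hL.norm_odd
      · simp only [Function.update_of_ne hkd]; exact hC.norm_odd k
    · refine hL.span.trans (sup_le (hC.span.trans (Submodule.span_mono ?_))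
        (Submodule.span_mono ?_))
      · rintro _ ⟨k, j, hj, l, hl, rfl⟩
        have := hk hj
        exact ⟨k, j, by rwa [Function.update_of_ne this], l, hl, by rw [Function.update_of_ne this]⟩
      · rintro _ ⟨j, hj, l, hl, rfl⟩
        exact ⟨d + 1, j, by rwa [Function.update_self], l, hl, by rw [Function.update_self]⟩
    · rw [Function.update_of_ne (by omega), ht k (by omega)]

end Chains

/-! ### Jordan bases, `sl₂`-triples and isotypic components -/

section Jordan

variable {V : Type*} [AddCommGroup V] [Module ℝ V]

/-- `B` consists of the vectors `X ^ l (v d j)` with `j < t d`, `l < d`, and `X ^ d (v d j) = 0`. -/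
structure IsJordanBasis (X : Module.End ℝ V) {t : ℕ → ℕ} (v : (d : ℕ) → Fin (t d) → V)
    (B : Module.Basis ((d : ℕ) × (Fin (t d) × Fin d)) ℝ V) : Prop where
  apply : ∀ d j l, B ⟨d, j, l⟩ = (X ^ (l : ℕ)) (v d j)
  pow_eq_zero : ∀ d j, (X ^ d) (v d j) = 0

/-- The vectors `x` with `X ^ d x = 0` on which `H` and `Y` act as on a lowest weight vector of
the irreducible `sl₂`-module of dimension `d`. -/
def ladder (X H Y : Module.End ℝ V) (d : ℕ) : Submodule ℝ V where
  carrier := {x | (X ^ d) x = 0 ∧ ∀ l < d, H ((X ^ l) x) = (2 * (l : ℝ) + 1 - d) • (X ^ l) x ∧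
    Y ((X ^ l) x) = ((l : ℝ) * (d - l)) • (X ^ (l - 1)) x}
  add_mem' := fun ha hb => ⟨by rw [map_add, ha.1, hb.1, add_zero], fun l hl => by
    simp only [map_add, (ha.2 l hl).1, (ha.2 l hl).2, (hb.2 l hl).1, (hb.2 l hl).2, smul_add,
      and_self]⟩
  zero_mem' := by simp
  smul_mem' := fun c x hx => ⟨by rw [map_smul, hx.1, smul_zero], fun l hl => by
    simp only [map_smul, (hx.2 l hl).1, (hx.2 l hl).2, smul_comm c, and_self]⟩

namespace IsJordanBasis

variable {X : Module.End ℝ V} {t : ℕ → ℕ} {v : (d : ℕ) → Fin (t d) → V}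
  {B : Module.Basis ((d : ℕ) × (Fin (t d) × Fin d)) ℝ V} (hB : IsJordanBasis X v B)
include hB

theorem repr_chain (d d' : ℕ) (j : Fin (t d)) (j' : Fin (t d')) (l : Fin d) (k : ℕ) :
    B.repr ((X ^ k) (v d' j')) ⟨d, j, l⟩ =
      if (⟨d, j⟩ : (d : ℕ) × Fin (t d)) = ⟨d', j'⟩ ∧ (l : ℕ) = k then 1 else 0 := by
  by_cases hk : k < d'
  · rw [← hB.apply d' j' ⟨k, hk⟩, B.repr_self, Finsupp.single_apply]
    refine if_congr ?_ rfl rfl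
    constructor
    · intro e
      cases e
      simp
    · rintro ⟨e, rfl⟩
      cases e
      simp
  · rw [pow_apply_eq_zero_of_le (not_lt.1 hk) (hB.pow_eq_zero d' j'), map_zero,
      Finsupp.zero_apply, if_neg]
    rintro ⟨e, rfl⟩
    cases e
    exact hk l.2

theorem repr_pow (k : ℕ) (x : V) (d : ℕ) (j : Fin (t d)) (l : Fin d) (hkl : k ≤ l) :
    B.repr ((X ^ k) x) ⟨d, j, l⟩ = B.repr x ⟨d, j, ⟨l - k, by omega⟩⟩ := by
  have : B.coord ⟨d, j, l⟩ ∘ₗ (X ^ k) = B.coord ⟨d, j, ⟨l - k, by omega⟩⟩ := by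
    refine B.ext ?_
    rintro ⟨d', j', l'⟩
    rw [LinearMap.comp_apply, Module.Basis.coord_apply, Module.Basis.coord_apply, hB.apply,
      ← Module.End.mul_apply, ← pow_add, hB.repr_chain, hB.repr_chain]
    refine if_congr (and_congr_right fun _ => ?_) rfl rfl
    simp only
    omega
  exact LinearMap.congr_fun this x

theorem repr_pow_of_lt (k : ℕ) (x : V) (d : ℕ) (j : Fin (t d)) (l : Fin d) (hkl : (l : ℕ) < k) :
    B.repr ((X ^ k) x) ⟨d, j, l⟩ = 0 := by
  have : B.coord ⟨d, j, l⟩ ∘ₗ (X ^ k) = 0 := by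
    refine B.ext ?_
    rintro ⟨d', j', l'⟩
    rw [LinearMap.comp_apply, Module.Basis.coord_apply, hB.apply,
      ← Module.End.mul_apply, ← pow_add, hB.repr_chain, if_neg, LinearMap.zero_apply]
    rintro ⟨-, h⟩
    omega
  exact LinearMap.congr_fun this x

/-- The neutral element of the `sl₂`-triple attached to a Jordan basis. -/
theorem exists_triple : ∃ H Y : Module.End ℝ V, (∀ d j, v d j ∈ ladder X H Y d) ∧
    H * X - X * H = (2 : ℝ) • X ∧ H * Y - Y * H = -(2 : ℝ) • Y ∧ X * Y - Y * X = H := by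
  -- The formulas for a lowest weight module of dimension `d`: weight `2 l + 1 - d`, and `Y` lowers
  -- with coefficient `l (d - l)`. The relation `[X, Y] = H` is the identity `l (d - l) - (l + 1) (d
  -- - l - 1) = 2 l + 1 - d`. At `l = 0` the truncated exponent `l - 1` is harmless, since the
  -- coefficient is zero.
  set H : Module.End ℝ V := B.constr ℝ fun i => (2 * (i.2.2 : ℕ) + 1 - (i.1 : ℝ)) • B i with hH
  set Y : Module.End ℝ V := B.constr ℝ fun i =>
    (((i.2.2 : ℕ) : ℝ) * ((i.1 : ℝ) - (i.2.2 : ℕ))) • (X ^ ((i.2.2 : ℕ) - 1)) (v i.1 i.2.1) with hY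
  have hHa : ∀ d j (l : ℕ), H ((X ^ l) (v d j)) = (2 * (l : ℝ) + 1 - d) • (X ^ l) (v d j) := by
    intro d j l
    by_cases hl : l < d
    · have := hB.apply d j ⟨l, hl⟩
      simp only at this
      rw [← this, hH, B.constr_basis]
    · rw [pow_apply_eq_zero_of_le (not_lt.1 hl) (hB.pow_eq_zero d j), map_zero, smul_zero]
  -- The case `l = d`, where both sides vanish, is needed for `[X, Y] = H` at the top of a chain.
  have hYa : ∀ d j (l : ℕ), l ≤ d →
      Y ((X ^ l) (v d j)) = ((l : ℝ) * (d - l)) • (X ^ (l - 1)) (v d j) := by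
    intro d j l hl
    rcases hl.lt_or_eq with hl | rfl
    · have := hB.apply d j ⟨l, hl⟩
      simp only at this
      rw [← this, hY, B.constr_basis]
    · rw [hB.pow_eq_zero, map_zero, sub_self, mul_zero, zero_smul]
  have hX : ∀ l x, X ((X ^ l) x) = (X ^ (l + 1)) x := fun l x => by
    rw [pow_succ', Module.End.mul_apply]
  refine ⟨H, Y, fun d j => ⟨hB.pow_eq_zero d j, fun l hl => ⟨hHa d j l, hYa d j l hl.le⟩⟩,
    B.ext ?_, B.ext ?_, B.ext ?_⟩
  · rintro ⟨d, j, l⟩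
    rw [hB.apply]
    simp only [LinearMap.sub_apply, Module.End.mul_apply, LinearMap.smul_apply, hX, hHa, map_smul]
    rw [← sub_smul]
    push_cast
    ring_nf
  · rintro ⟨d, j, l⟩
    rw [hB.apply]
    simp only [LinearMap.sub_apply, Module.End.mul_apply, LinearMap.smul_apply, hHa, map_smul,
      hYa d j l l.2.le]
    rcases Nat.eq_zero_or_pos (l : ℕ) with h0 | h0
    · simp [h0]
    · rw [smul_smul, smul_smul, smul_smul, ← sub_smul, Nat.cast_sub h0]
      push_cast
      ring_nf
  · rintro ⟨d, j, l⟩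
    rw [hB.apply]
    simp only [LinearMap.sub_apply, Module.End.mul_apply, hX, hHa, map_smul,
      hYa d j l l.2.le, hYa d j (l + 1) l.2]
    rcases Nat.eq_zero_or_pos (l : ℕ) with h0 | h0
    · simp only [h0]
      simp [← neg_smul]
    · rw [Nat.sub_add_cancel h0, Nat.add_sub_cancel, ← sub_smul]
      push_cast
      ring_nf

variable {H Y : Module.End ℝ V} (hL : ∀ d j, v d j ∈ ladder X H Y d)
include hL

theorem repr_H (x : V) (i : (d : ℕ) × (Fin (t d) × Fin d)) :
    B.repr (H x) i = (2 * (i.2.2 : ℕ) + 1 - (i.1 : ℝ)) * B.repr x i := by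
  have : B.coord i ∘ₗ H = (2 * (i.2.2 : ℕ) + 1 - (i.1 : ℝ)) • B.coord i := by
    refine B.ext ?_
    rintro ⟨d', j', l'⟩
    rw [LinearMap.comp_apply, LinearMap.smul_apply, hB.apply, ((hL d' j').2 l' l'.2).1, map_smul,
      ← hB.apply, Module.Basis.coord_apply, B.repr_self]
    by_cases e : (⟨d', j', l'⟩ : (d : ℕ) × (Fin (t d) × Fin d)) = i
    · subst e; rfl
    · simp [e]
  exact LinearMap.congr_fun this x

theorem repr_Y (x : V) (d : ℕ) (j : Fin (t d)) (l : ℕ) (hl : l + 1 < d) :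
    B.repr (Y x) ⟨d, j, ⟨l, by omega⟩⟩ =
      ((l + 1 : ℝ) * (d - (l + 1))) * B.repr x ⟨d, j, ⟨l + 1, hl⟩⟩ := by
  have : B.coord ⟨d, j, ⟨l, by omega⟩⟩ ∘ₗ Y =
      ((l + 1 : ℝ) * (d - (l + 1))) • B.coord ⟨d, j, ⟨l + 1, hl⟩⟩ := by
    refine B.ext ?_
    rintro ⟨d', j', l'⟩
    rw [LinearMap.comp_apply, LinearMap.smul_apply, hB.apply, ((hL d' j').2 l' l'.2).2, map_smul,
      Module.Basis.coord_apply, Module.Basis.coord_apply, hB.repr_chain, hB.repr_chain]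
    by_cases e : (⟨d, j⟩ : (d : ℕ) × Fin (t d)) = ⟨d', j'⟩
    · cases e
      by_cases e' : l + 1 = l'
      · have : l = (l' : ℕ) - 1 := by omega
        simp [← e']
      · rcases Nat.eq_zero_or_pos (l' : ℕ) with h0 | h0
        · simp [h0]
        · have : l ≠ (l' : ℕ) - 1 := by omega
          simp [this, e']
    · simp [e]
  exact LinearMap.congr_fun this x

/-- Inside a chain the coefficients `(l + 1) (d - l - 1)` of `Y` are nonzero, so `ker Y` involves
only the bottoms of the chains. -/
theorem repr_eq_zero_of_lowest {x : V} (hx : Y x = 0) (d : ℕ) (j : Fin (t d)) (l : Fin d)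
    (hl : (l : ℕ) ≠ 0) : B.repr x ⟨d, j, l⟩ = 0 := by
  obtain ⟨l, hld⟩ := l
  obtain ⟨l, rfl⟩ := Nat.exists_eq_succ_of_ne_zero hl
  have := hB.repr_Y hL x d j l hld
  rw [hx, map_zero, Finsupp.zero_apply] at this
  refine (mul_eq_zero.1 this.symm).resolve_left (mul_ne_zero (by positivity) ?_)
  have : ((l + 1 : ℕ) : ℝ) < d := by exact_mod_cast hld
  push_cast at this
  linarith

theorem mem_span_of_lowest {x : V} {d : ℕ} (hx : Y x = 0)
    (hd : ∀ i, B.repr x i ≠ 0 → i.1 = d) : x ∈ Submodule.span ℝ (Set.range (v d)) := by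
  have : x ∈ Submodule.span ℝ (B '' {i | i.1 = d ∧ (i.2.2 : ℕ) = 0}) := by
    rw [B.mem_span_image]
    rintro ⟨d', j, l⟩ hi
    rw [Finset.mem_coe, Finsupp.mem_support_iff] at hi
    exact ⟨hd _ hi, not_imp_comm.1 (hB.repr_eq_zero_of_lowest hL hx d' j l) hi⟩
  refine Submodule.span_mono ?_ this
  rintro _ ⟨⟨d', j, l⟩, ⟨rfl, hl⟩, rfl⟩
  simp only at hl
  exact ⟨j, by rw [hB.apply, hl, pow_zero, Module.End.one_apply]⟩

/-- At the bottom of a chain the weight is `1 - d`, which determines the length `d`; a lowest weight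
vector thus involves chains of a single length. -/
theorem exists_mem_span_of_weight {x : V} (hx0 : x ≠ 0) {μ : ℝ} (hY : Y x = 0)
    (hH : H x = μ • x) : ∃ d, x ∈ Submodule.span ℝ (Set.range (v d)) := by
  have hμ : ∀ i, B.repr x i ≠ 0 → μ = 1 - (i.1 : ℝ) := by
    rintro ⟨d, j, l⟩ hi
    have h0 : (l : ℕ) = 0 := not_imp_comm.1 (hB.repr_eq_zero_of_lowest hL hY d j l) hi
    have := hB.repr_H hL x ⟨d, j, l⟩
    rw [hH, map_smul, Finsupp.smul_apply, smul_eq_mul] at this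
    rw [mul_right_cancel₀ hi this]
    simp [h0]
  obtain ⟨i, hi⟩ : ∃ i, B.repr x i ≠ 0 := by
    by_contra! hcon
    exact hx0 (B.repr.map_eq_zero_iff.1 (Finsupp.ext hcon))
  refine ⟨i.1, hB.mem_span_of_lowest hL hY fun i' hi' => ?_⟩
  have := (hμ i' hi').symm.trans (hμ i hi)
  exact_mod_cast (sub_right_inj.1 this)

theorem exists_pow_apply_eq_zero (x : V) : ∃ k, (Y ^ k) x = 0 := by
  have hmem : x ∈ Submodule.span ℝ (Set.range B) := by rw [B.span_eq]; trivial
  induction hmem using Submodule.span_induction with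
  | mem y hy =>
    obtain ⟨⟨d, j, l⟩, rfl⟩ := hy
    refine ⟨l + 1, ?_⟩
    rw [hB.apply]
    obtain ⟨l, hl⟩ := l
    simp only
    induction l with
    | zero => simpa using ((hL d j).2 0 hl).2
    | succ l ih =>
      rw [pow_succ, Module.End.mul_apply, ((hL d j).2 (l + 1) hl).2, map_smul,
        Nat.add_sub_cancel, ih (by omega), smul_zero]
  | zero => exact ⟨0, map_zero _⟩
  | add y z _ _ hy hz =>
    obtain ⟨a, ha⟩ := hy
    obtain ⟨b, hb⟩ := hz
    exact ⟨max a b, by rw [map_add, pow_apply_eq_zero_of_le (le_max_left a b) ha,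
      pow_apply_eq_zero_of_le (le_max_right a b) hb, add_zero]⟩
  | smul c y _ hy =>
    obtain ⟨a, ha⟩ := hy
    exact ⟨a, by rw [map_smul, ha, smul_zero]⟩

theorem iSup_eigenspace_eq_top : ⨆ μ, H.genEigenspace μ 1 = ⊤ := by
  rw [eq_top_iff, ← B.span_eq, Submodule.span_le]
  rintro _ ⟨⟨d, j, l⟩, rfl⟩
  refine Submodule.mem_iSup_of_mem (2 * ((l : ℕ) : ℝ) + 1 - d) ?_
  refine Module.End.mem_eigenspace_iff.2 ?_
  rw [hB.apply]
  exact ((hL d j).2 l l.2).1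

/-- The last nonzero `Y ^ k x` shows that `W` meets `ker Y`. The intersection is stable under `H`
because `[H, Y] = -2 Y`, and `H` is diagonalisable, so it contains an eigenvector. -/
theorem exists_weight_vector [FiniteDimensional ℝ V] (hHY : H * Y - Y * H = -(2 : ℝ) • Y)
    {W : Submodule ℝ V} (hW : W ≠ ⊥) (hWH : ∀ x ∈ W, H x ∈ W) (hWY : ∀ x ∈ W, Y x ∈ W) :
    ∃ x ∈ W, x ≠ 0 ∧ ∃ d, x ∈ Submodule.span ℝ (Set.range (v d)) := by
  have h1 : W ⊓ LinearMap.ker Y ≠ ⊥ := by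
    obtain ⟨x, hx, hx0⟩ := Submodule.exists_mem_ne_zero_of_ne_bot hW
    classical
    have hk := hB.exists_pow_apply_eq_zero hL x
    obtain ⟨k, hk'⟩ : ∃ k, Nat.find hk = k + 1 := Nat.exists_eq_succ_of_ne_zero fun h0 => hx0 <| by
      have := Nat.find_spec hk
      rwa [h0, pow_zero, Module.End.one_apply] at this
    have h2 : (Y ^ k) x ≠ 0 := Nat.find_min hk (by omega)
    have h3 : Y ((Y ^ k) x) = 0 := by
      have := Nat.find_spec hk
      rwa [hk', pow_succ', Module.End.mul_apply] at this
    exact Submodule.ne_bot_iff _ |>.2 ⟨_, ⟨pow_apply_mem hWY k hx, h3⟩, h2⟩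
  have h4 : ∀ x ∈ W ⊓ LinearMap.ker Y, H x ∈ W ⊓ LinearMap.ker Y := by
    rintro x ⟨hx, hx'⟩
    refine ⟨hWH x hx, ?_⟩
    rw [SetLike.mem_coe, LinearMap.mem_ker] at hx' ⊢
    have := LinearMap.congr_fun hHY x
    simp only [LinearMap.sub_apply, Module.End.mul_apply, LinearMap.smul_apply, hx', map_zero,
      smul_zero, zero_sub, neg_eq_zero] at this
    exact this
  have h5 := Submodule.inf_iSup_genEigenspace h4 1
  rw [hB.iSup_eigenspace_eq_top hL, inf_top_eq] at h5
  obtain ⟨μ, hμ⟩ : ∃ μ, (W ⊓ LinearMap.ker Y) ⊓ H.genEigenspace μ 1 ≠ ⊥ := by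
    by_contra! hcon
    exact h1 (by rw [h5]; simp [hcon])
  obtain ⟨x, ⟨⟨hx, hx'⟩, hx''⟩, hx0⟩ := Submodule.exists_mem_ne_zero_of_ne_bot hμ
  refine ⟨x, hx, hx0, hB.exists_mem_span_of_weight hL hx0 (μ := μ) hx' ?_⟩
  exact Module.End.mem_eigenspace_iff.1 hx''

end IsJordanBasis

/-- `W` is stable under `X`, `H` and `Y`. -/
def IsStableEnd (X H Y : Module.End ℝ V) (W : Submodule ℝ V) : Prop :=
  ∀ w ∈ W, X w ∈ W ∧ H w ∈ W ∧ Y w ∈ W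

/-- `W` is irreducible under `X`, `H` and `Y`. -/
def IsIrredEnd (X H Y : Module.End ℝ V) (W : Submodule ℝ V) : Prop :=
  W ≠ ⊥ ∧ IsStableEnd X H Y W ∧
    ∀ U : Submodule ℝ V, U ≤ W → IsStableEnd X H Y U → U = ⊥ ∨ U = W

/-- The span of the chain `x, X x, …, X ^ (d - 1) x`. -/
def chainSpan (X : Module.End ℝ V) (d : ℕ) (x : V) : Submodule ℝ V :=
  Submodule.span ℝ (Set.range fun l : Fin d => (X ^ (l : ℕ)) x)

theorem pow_mem_chainSpan {X : Module.End ℝ V} {d : ℕ} {x : V} (hx : (X ^ d) x = 0) (l : ℕ) :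
    (X ^ l) x ∈ chainSpan X d x := by
  by_cases hl : l < d
  · exact Submodule.subset_span ⟨⟨l, hl⟩, rfl⟩
  · rw [pow_apply_eq_zero_of_le (not_lt.1 hl) hx]
    exact Submodule.zero_mem _

theorem chainSpan_le {X : Module.End ℝ V} {d : ℕ} {x : V} {W : Submodule ℝ V} (hx : x ∈ W)
    (hW : ∀ w ∈ W, X w ∈ W) : chainSpan X d x ≤ W := by
  rw [chainSpan, Submodule.span_le]
  rintro _ ⟨l, rfl⟩
  exact pow_apply_mem hW l hx

theorem isStableEnd_chainSpan {X H Y : Module.End ℝ V} {d : ℕ} {x : V}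
    (hx : x ∈ ladder X H Y d) : IsStableEnd X H Y (chainSpan X d x) := by
  have hle : chainSpan X d x ≤ (chainSpan X d x).comap X ⊓
      ((chainSpan X d x).comap H ⊓ (chainSpan X d x).comap Y) := by
    conv_lhs => rw [chainSpan]
    rw [Submodule.span_le]
    rintro _ ⟨l, rfl⟩
    refine ⟨?_, ?_, ?_⟩
    · change X ((X ^ (l : ℕ)) x) ∈ chainSpan X d x
      rw [← Module.End.mul_apply, ← pow_succ']
      exact pow_mem_chainSpan hx.1 _
    · change H ((X ^ (l : ℕ)) x) ∈ chainSpan X d x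
      rw [(hx.2 l l.2).1]
      exact Submodule.smul_mem _ _ (pow_mem_chainSpan hx.1 _)
    · change Y ((X ^ (l : ℕ)) x) ∈ chainSpan X d x
      rw [(hx.2 l l.2).2]
      exact Submodule.smul_mem _ _ (pow_mem_chainSpan hx.1 _)
  exact fun w hw => ⟨(hle hw).1, (hle hw).2.1, (hle hw).2.2⟩

theorem span_le_ladder {X H Y : Module.End ℝ V} {t : ℕ → ℕ} {v : (d : ℕ) → Fin (t d) → V}
    (hL : ∀ d j, v d j ∈ ladder X H Y d) (d : ℕ) :
    Submodule.span ℝ (Set.range (v d)) ≤ ladder X H Y d := by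
  rw [Submodule.span_le]
  rintro _ ⟨j, rfl⟩
  exact hL d j

namespace IsJordanBasis

variable {X : Module.End ℝ V} {t : ℕ → ℕ} {v : (d : ℕ) → Fin (t d) → V}
  {B : Module.Basis ((d : ℕ) × (Fin (t d) × Fin d)) ℝ V} (hB : IsJordanBasis X v B)
include hB

theorem repr_of_mem_span {d : ℕ} {x : V} (hx : x ∈ Submodule.span ℝ (Set.range (v d)))
    (i : (d : ℕ) × (Fin (t d) × Fin d)) (hi : B.repr x i ≠ 0) : i.1 = d ∧ (i.2.2 : ℕ) = 0 := by
  obtain ⟨d', j, l⟩ := i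
  by_contra hcon
  apply hi
  have : Submodule.span ℝ (Set.range (v d)) ≤ LinearMap.ker (B.coord ⟨d', j, l⟩) := by
    rw [Submodule.span_le]
    rintro _ ⟨j', rfl⟩
    rw [SetLike.mem_coe, LinearMap.mem_ker, Module.Basis.coord_apply]
    have := hB.repr_chain d' d j j' l 0
    rw [pow_zero, Module.End.one_apply] at this
    rw [this, if_neg]
    rintro ⟨e, h⟩
    exact hcon ⟨congrArg Sigma.fst e, h⟩
  exact this hx

theorem exists_repr_ne_zero {d : ℕ} {x : V} (hx : x ∈ Submodule.span ℝ (Set.range (v d)))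
    (hx0 : x ≠ 0) : ∃ (hd : 0 < d) (j : Fin (t d)), B.repr x ⟨d, j, ⟨0, hd⟩⟩ ≠ 0 := by
  obtain ⟨⟨d', j, ⟨l, hl⟩⟩, hi⟩ : ∃ i, B.repr x i ≠ 0 := by
    by_contra! hcon
    exact hx0 (B.repr.map_eq_zero_iff.1 (Finsupp.ext hcon))
  obtain ⟨h1, h2⟩ := hB.repr_of_mem_span hx _ hi
  simp only at h1 h2
  subst h1 h2
  exact ⟨hl, j, hi⟩

variable {H Y : Module.End ℝ V} (hL : ∀ d j, v d j ∈ ladder X H Y d)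
include hL

/-- The vectors of the chain are eigenvectors of `H` with distinct weights; they are nonzero because
`X ^ l` moves a nonzero bottom coordinate to height `l`. -/
theorem finrank_chainSpan {d : ℕ} {x : V} (hx : x ∈ Submodule.span ℝ (Set.range (v d)))
    (hx0 : x ≠ 0) : Module.finrank ℝ (chainSpan X d x) = d := by
  obtain ⟨hd, j, hj⟩ := hB.exists_repr_ne_zero hx hx0
  have hx' := span_le_ladder hL d hx
  have hli : LinearIndependent ℝ fun l : Fin d => (X ^ (l : ℕ)) x := by
    refine Module.End.eigenvectors_linearIndependent' H
      (fun l : Fin d => 2 * ((l : ℕ) : ℝ) + 1 - d) ?_ _ fun l => ⟨?_, ?_⟩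
    · intro a b hab
      simp only [sub_left_inj, add_left_inj, mul_eq_mul_left_iff, Nat.cast_inj,
        OfNat.ofNat_ne_zero, or_false] at hab
      exact Fin.ext hab
    · exact Module.End.mem_eigenspace_iff.2 (hx'.2 l l.2).1
    · intro h0
      have := hB.repr_pow l x d j l le_rfl
      rw [h0, map_zero, Finsupp.zero_apply] at this
      simp only [Nat.sub_self] at this
      exact hj this.symm
  rw [chainSpan, finrank_span_eq_card hli, Fintype.card_fin]

/-- A nonzero stable subspace contains a lowest weight vector. The bottom coordinates of the chain
occur only in rows of length `d`, so the chain of that vector also has dimension `d` and fills the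
whole span. -/
theorem isIrredEnd_chainSpan [FiniteDimensional ℝ V] (hHY : H * Y - Y * H = -(2 : ℝ) • Y) {d : ℕ}
    {x : V} (hx : x ∈ Submodule.span ℝ (Set.range (v d))) (hx0 : x ≠ 0) :
    IsIrredEnd X H Y (chainSpan X d x) := by
  have hx' := span_le_ladder hL d hx
  refine ⟨fun h0 => hx0 ?_, isStableEnd_chainSpan hx', fun U hUx hU => or_iff_not_imp_left.2
    fun hU0 => ?_⟩
  · have := pow_mem_chainSpan hx'.1 0
    rwa [h0, Submodule.mem_bot, pow_zero, Module.End.one_apply] at this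
  · obtain ⟨w, hw, hw0, d', hwd⟩ := hB.exists_weight_vector hL hHY hU0 (fun y hy => (hU y hy).2.1)
      fun y hy => (hU y hy).2.2
    have hdd : d' = d := by
      obtain ⟨hd', j, hj⟩ := hB.exists_repr_ne_zero hwd hw0
      by_contra hne
      apply hj
      have : chainSpan X d x ≤ LinearMap.ker (B.coord ⟨d', j, ⟨0, hd'⟩⟩) := by
        rw [chainSpan, Submodule.span_le]
        rintro _ ⟨⟨l, hl⟩, rfl⟩
        rw [SetLike.mem_coe, LinearMap.mem_ker, Module.Basis.coord_apply]
        simp only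
        rcases Nat.eq_zero_or_pos l with rfl | h0
        · by_contra hcon
          rw [pow_zero, Module.End.one_apply] at hcon
          exact hne (hB.repr_of_mem_span hx _ hcon).1
        · exact hB.repr_pow_of_lt l x d' j _ h0
      exact this (hUx hw)
    subst hdd
    refine le_antisymm hUx ?_
    have h1 : chainSpan X d' w ≤ U := chainSpan_le hw fun y hy => (hU y hy).1
    have h2 : chainSpan X d' w = chainSpan X d' x := Submodule.eq_of_le_of_finrank_eq (h1.trans hUx)
      (by rw [hB.finrank_chainSpan hL hwd hw0, hB.finrank_chainSpan hL hx hx0])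
    rwa [h2] at h1

/-- The isotypic components are spanned by the chains of the given length. -/
theorem sSup_irred_eq [FiniteDimensional ℝ V] (hHY : H * Y - Y * H = -(2 : ℝ) • Y) (d : ℕ) :
    sSup {W | IsIrredEnd X H Y W ∧ Module.finrank ℝ W = d} = Submodule.span ℝ
      (Set.range fun i : Fin (t d) × Fin d => (X ^ (i.2 : ℕ)) (v d i.1)) := by
  apply le_antisymm
  · refine sSup_le ?_
    rintro W ⟨⟨hW0, hW, hW'⟩, hWd⟩
    obtain ⟨w, hw, hw0, d', hwd⟩ := hB.exists_weight_vector hL hHY hW0 (fun y hy => (hW y hy).2.1)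
      fun y hy => (hW y hy).2.2
    have hirr := hB.isIrredEnd_chainSpan hL hHY hwd hw0
    -- An irreducible `W` is the chain of any lowest weight vector in it, so its dimension is the
    -- length of the rows involved.
    have h1 := (hW' _ (chainSpan_le hw fun y hy => (hW y hy).1) hirr.2.1).resolve_left hirr.1
    have h2 : d' = d := by rw [← hWd, ← h1, hB.finrank_chainSpan hL hwd hw0]
    subst h2
    rw [← h1, chainSpan, Submodule.span_le]
    rintro _ ⟨l, rfl⟩
    have : Submodule.span ℝ (Set.range (v d')) ≤ (Submodule.span ℝ (Set.range
        fun i : Fin (t d') × Fin d' => (X ^ (i.2 : ℕ)) (v d' i.1))).comap (X ^ (l : ℕ)) := by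
      rw [Submodule.span_le]
      rintro _ ⟨j, rfl⟩
      exact Submodule.subset_span ⟨(j, l), rfl⟩
    exact this hwd
  · rw [Submodule.span_le]
    rintro _ ⟨⟨j, l⟩, rfl⟩
    have hv0 : v d j ≠ 0 := by
      intro h0
      have := hB.apply d j ⟨0, l.pos⟩
      rw [h0, map_zero] at this
      exact B.ne_zero _ this
    have hv : v d j ∈ Submodule.span ℝ (Set.range (v d)) := Submodule.subset_span ⟨j, rfl⟩
    exact le_sSup (show chainSpan X d (v d j) ∈
      {W | IsIrredEnd X H Y W ∧ Module.finrank ℝ W = d} from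
      ⟨hB.isIrredEnd_chainSpan hL hHY hv hv0, hB.finrank_chainSpan hL hv hv0⟩) (pow_mem_chainSpan (hL d j).1 l)

theorem ker_inf_span_eq (d : ℕ) : LinearMap.ker Y ⊓ Submodule.span ℝ
      (Set.range fun i : Fin (t d) × Fin d => (X ^ (i.2 : ℕ)) (v d i.1)) =
    Submodule.span ℝ (Set.range (v d)) := by
  apply le_antisymm
  · rintro x ⟨hx, hx'⟩
    refine hB.mem_span_of_lowest hL hx ?_
    rintro ⟨d', j, l⟩ hi
    by_contra hne
    apply hi
    have : Submodule.span ℝ (Set.range fun i : Fin (t d) × Fin d => (X ^ (i.2 : ℕ)) (v d i.1)) ≤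
        LinearMap.ker (B.coord ⟨d', j, l⟩) := by
      rw [Submodule.span_le]
      rintro _ ⟨i, rfl⟩
      rw [SetLike.mem_coe, LinearMap.mem_ker, Module.Basis.coord_apply, hB.repr_chain, if_neg]
      rintro ⟨e, -⟩
      exact hne (congrArg Sigma.fst e)
    exact this hx'
  · rw [Submodule.span_le]
    rintro _ ⟨j, rfl⟩
    rcases Nat.eq_zero_or_pos d with rfl | hd
    · have : v 0 j = 0 := by simpa using (hL 0 j).1
      rw [this]
      exact Submodule.zero_mem _
    · refine ⟨?_, Submodule.subset_span ⟨(j, ⟨0, hd⟩), by simp⟩⟩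
      have := ((hL d j).2 0 hd).2
      rw [SetLike.mem_coe, LinearMap.mem_ker]
      simpa using this

end IsJordanBasis

end Jordan

theorem linearIndependent_of_dual {V ι : Type*} [AddCommGroup V] [Module ℝ V] {b : ι → V}
    (f : ι → V →ₗ[ℝ] ℝ) (h0 : ∀ i j, f i (b j) ≠ 0 → j = i) (h1 : ∀ i, f i (b i) ≠ 0) :
    LinearIndependent ℝ b := by
  rw [linearIndependent_iff']
  intro s g hg i hi
  have := congrArg (f i) hg
  rw [map_sum, map_zero, Finset.sum_eq_single i, map_smul, smul_eq_mul] at this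
  · exact (mul_eq_zero.1 this).resolve_right (h1 i)
  · intro j _ hj
    rw [map_smul, not_imp_comm.1 (h0 i j) hj, smul_zero]
  · exact fun h => absurd hi h

/-! ### From the Gram matrix to a basis and to skewness of the triple -/

section Chains

variable {V : Type*} [AddCommGroup V] [Module ℝ V] {ω : LinearMap.BilinForm ℝ V}
  {X : Module.End ℝ V} (h : IsSkewPair ω X) {t : ℕ → ℕ} {v : ℕ → ℕ → V}
  (hC : IsChainSystem ω X ⊤ t v)
include h hC

theorem IsChainSystem.gram_pow {d d' j j' l l' : ℕ} (hj : j < t d) (hj' : j' < t d')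
    (hne : ω ((X ^ l) (v d j)) ((X ^ l') (v d' j')) ≠ 0) :
    d = d' ∧ l + l' + 1 = d ∧
      ((Even d ∧ j = j') ∨ (Odd d ∧ (j' = j + t d / 2 ∨ j = j' + t d / 2))) := by
  rw [h.pow_pow] at hne
  exact hC.gram d d' j hj j' hj' _ (right_ne_zero_of_mul hne)

/-- In each row and column the Gram matrix has exactly one nonzero entry. Pairing with the partner
gives a dual family of functionals, hence linear independence. In odd length this uses that `t d` is
even, so that `j` and `j ± t d / 2` are matched. -/
theorem IsChainSystem.exists_partner (i : (d : ℕ) × (Fin (t d) × Fin d)) :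
    ∃ y, ω y ((X ^ (i.2.2 : ℕ)) (v i.1 i.2.1)) ≠ 0 ∧ ∀ k : (d : ℕ) × (Fin (t d) × Fin d),
      ω y ((X ^ (k.2.2 : ℕ)) (v k.1 k.2.1)) ≠ 0 → k = i := by
  obtain ⟨d, ⟨j, hj⟩, ⟨l, hl⟩⟩ := i
  simp only
  have hl' : d - 1 - l + l = d - 1 := by omega
  obtain ⟨j', hj', hne, huniq⟩ : ∃ j' < t d, ω (v d j') ((X ^ (d - 1)) (v d j)) ≠ 0 ∧
      ∀ k < t d, ((Even d ∧ j' = k) ∨ (Odd d ∧ (k = j' + t d / 2 ∨ j' = k + t d / 2))) →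
        k = j := by
    rcases Nat.even_or_odd d with hd | hd
    · refine ⟨j, hj, ?_, fun k _ hk => ?_⟩
      · rcases hC.norm_even d hd j hj with h' | h' <;> rw [h'] <;> norm_num
      · rcases hk with hk | hk
        · exact hk.2.symm
        · exact absurd hk.1 (Nat.not_odd_iff_even.2 hd)
    · have ht : t d / 2 + t d / 2 = t d := by
        obtain ⟨m, hm⟩ := hC.even_card d hd
        omega
      by_cases hjt : j < t d / 2
      · refine ⟨j + t d / 2, by omega, ?_, fun k hk hk' => ?_⟩
        · rw [h.pow_symm, hC.norm_odd d hd j hj (j + t d / 2) (by omega) rfl]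
          simp
        · rcases hk' with hk' | hk'
          · exact absurd hd (Nat.not_odd_iff_even.2 hk'.1)
          · omega
      · refine ⟨j - t d / 2, by omega, ?_, fun k hk hk' => ?_⟩
        · rw [hC.norm_odd d hd (j - t d / 2) (by omega) j hj (by omega)]
          simp
        · rcases hk' with hk' | hk'
          · exact absurd hd (Nat.not_odd_iff_even.2 hk'.1)
          · omega
  refine ⟨(X ^ (d - 1 - l)) (v d j'), ?_, ?_⟩
  · rw [h.pow_pow, hl']
    exact mul_ne_zero (by simp) hne
  · rintro ⟨d', ⟨k, hk⟩, ⟨l', hl''⟩⟩ hne'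
    obtain ⟨h1, h2, h3⟩ := hC.gram_pow h hj' hk hne'
    subst h1
    have h4 := huniq k hk h3
    have h5 : l' = l := by simp only at h2; omega
    subst h4 h5
    rfl

theorem IsChainSystem.exists_basis :
    ∃ B : Module.Basis ((d : ℕ) × (Fin (t d) × Fin d)) ℝ V,
      IsJordanBasis X (fun d (j : Fin (t d)) => v d j) B := by
  choose y hy hy' using hC.exists_partner h
  have hli : LinearIndependent ℝ fun i : (d : ℕ) × (Fin (t d) × Fin d) =>
      (X ^ (i.2.2 : ℕ)) (v i.1 i.2.1) :=
    linearIndependent_of_dual (fun i => ω (y i)) hy' hy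
  have hsp : ⊤ ≤ Submodule.span ℝ (Set.range fun i : (d : ℕ) × (Fin (t d) × Fin d) =>
      (X ^ (i.2.2 : ℕ)) (v i.1 i.2.1)) := by
    refine hC.span.trans (Submodule.span_mono ?_)
    rintro _ ⟨d, j, hj, l, hl, rfl⟩
    exact ⟨⟨d, ⟨j, hj⟩, ⟨l, hl⟩⟩, rfl⟩
  refine ⟨Module.Basis.mk hli hsp, fun d j l => ?_, fun d j => hC.pow_eq_zero d j j.2⟩
  rw [Module.Basis.mk_apply]

variable {B : Module.Basis ((d : ℕ) × (Fin (t d) × Fin d)) ℝ V}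
  (hB : IsJordanBasis X (fun d (j : Fin (t d)) => v d j) B) {H Y : Module.End ℝ V}
  (hL : ∀ d (j : Fin (t d)), v d j ∈ ladder X H Y d)
include hB hL

/-- Chain vectors pair nontrivially only if `l + l' + 1 = d`, and then their weights are opposite.
-/
theorem IsChainSystem.skew_H (x y : V) : ω (H x) y = -ω x (H y) := by
  have : LinearMap.comp ω H = -(ω.compl₂ H) := by
    refine LinearMap.ext_basis B B ?_
    rintro ⟨d, j, l⟩ ⟨d', j', l'⟩
    rw [LinearMap.comp_apply, LinearMap.neg_apply, LinearMap.neg_apply, LinearMap.compl₂_apply,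
      hB.apply, hB.apply, ((hL d j).2 l l.2).1, ((hL d' j').2 l' l'.2).1, map_smul, map_smul,
      LinearMap.smul_apply]
    by_cases h0 : ω ((X ^ (l : ℕ)) (v d j)) ((X ^ (l' : ℕ)) (v d' j')) = 0
    · rw [h0, smul_zero, smul_zero, neg_zero]
    · obtain ⟨h1, h2, -⟩ := hC.gram_pow h j.2 j'.2 h0
      have h1' : (d' : ℝ) = d := by rw [h1]
      rw [smul_eq_mul, smul_eq_mul, ← neg_mul, h1']
      congr 1
      have : ((l + l' + 1 : ℕ) : ℝ) = d := congrArg _ h2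
      push_cast at this
      linarith
  exact LinearMap.congr_fun₂ this x y

/-- Only `l + l' = d` matters; then both lowering coefficients are `l l'`, and moving one more power
of `X` across the form gives the sign. -/
theorem IsChainSystem.skew_Y (x y : V) : ω (Y x) y = -ω x (Y y) := by
  have : LinearMap.comp ω Y = -(ω.compl₂ Y) := by
    refine LinearMap.ext_basis B B ?_
    rintro ⟨d, j, ⟨l, hl⟩⟩ ⟨d', j', ⟨l', hl'⟩⟩
    rw [LinearMap.comp_apply, LinearMap.neg_apply, LinearMap.neg_apply, LinearMap.compl₂_apply,
      hB.apply, hB.apply, ((hL d j).2 l hl).2, ((hL d' j').2 l' hl').2, map_smul, map_smul,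
      LinearMap.smul_apply, h.pow_pow, h.pow_pow, smul_eq_mul, smul_eq_mul]
    simp only
    have key : ∀ m, ω (v d j) ((X ^ m) (v d' j')) ≠ 0 → d = d' ∧ m + 1 = d := fun m hm => by
      obtain ⟨h1, h2, -⟩ := hC.gram d d' j j.2 j' j'.2 m hm
      exact ⟨h1, h2⟩
    rcases Nat.eq_zero_or_pos l with rfl | hl0 <;> rcases Nat.eq_zero_or_pos l' with rfl | hl0'
    · simp
    · by_cases h0 : ω (v d j) ((X ^ (0 + (l' - 1))) (v d' j')) = 0
      · rw [h0]; simp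
      · have := key _ h0
        omega
    · by_cases h0 : ω (v d j) ((X ^ (l - 1 + 0)) (v d' j')) = 0
      · rw [h0]; simp
      · have := key _ h0
        omega
    · rw [show l + (l' - 1) = l - 1 + l' by omega]
      by_cases h0 : ω (v d j) ((X ^ (l - 1 + l')) (v d' j')) = 0
      · rw [h0]; simp
      · obtain ⟨h1, h2⟩ := key _ h0
        have h3 : (l : ℝ) + l' = d := by exact_mod_cast (by omega : l + l' = d)
        obtain ⟨m, rfl⟩ := Nat.exists_eq_succ_of_ne_zero hl0.ne'
        have h1' : (d' : ℝ) = d := by rw [h1]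
        rw [h1', ← h3, Nat.succ_sub_one, pow_succ]
        ring
  exact LinearMap.congr_fun₂ this x y

end Chains

/-! ### Matrices and endomorphisms -/

section Matrices

variable {n : ℕ}

/-- The symplectic form as a bilinear form. -/
def bform (n : ℕ) : LinearMap.BilinForm ℝ (Vec n) := Matrix.toLinearMap₂' ℝ (J (Fin n) ℝ)

theorem bform_apply (x y : Vec n) : bform n x y = form x y := Matrix.toLinearMap₂'_apply' _ _ _

/-- The endomorphism attached to a matrix. -/
def toEnd (A : Mat n) : Module.End ℝ (Vec n) := Matrix.toLinAlgEquiv' A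

theorem toEnd_apply (A : Mat n) (x : Vec n) : toEnd A x = A *ᵥ x := Matrix.toLinAlgEquiv'_apply _ _

theorem toEnd_pow_apply (A : Mat n) (k : ℕ) (x : Vec n) : (toEnd A ^ k) x = (A ^ k) *ᵥ x := by
  rw [toEnd, ← map_pow, ← toEnd, toEnd_apply]

theorem toEnd_injective : Function.Injective (toEnd (n := n)) := Matrix.toLinAlgEquiv'.injective

theorem form_mulVec_left (A : Mat n) (x y : Vec n) :
    form (A *ᵥ x) y = x ⬝ᵥ ((Aᵀ * J (Fin n) ℝ) *ᵥ y) := by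
  rw [form, ← Matrix.vecMul_transpose, ← Matrix.dotProduct_mulVec, Matrix.mulVec_mulVec]

theorem form_mulVec_right (A : Mat n) (x y : Vec n) :
    form x (A *ᵥ y) = x ⬝ᵥ ((J (Fin n) ℝ * A) *ᵥ y) := by
  rw [form, Matrix.mulVec_mulVec]

theorem eq_of_dotProduct_mulVec {A B : Mat n}
    (h : ∀ x y : Vec n, x ⬝ᵥ (A *ᵥ y) = x ⬝ᵥ (B *ᵥ y)) : A = B := by
  refine Matrix.toLinAlgEquiv'.injective (LinearMap.ext fun y => ?_)
  rw [Matrix.toLinAlgEquiv'_apply, Matrix.toLinAlgEquiv'_apply]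
  exact dotProduct_eq _ _ fun x => by rw [dotProduct_comm, h, dotProduct_comm]

theorem mem_sp_iff (A : Mat n) : A ∈ LieAlgebra.Symplectic.sp (Fin n) ℝ ↔
    Aᵀ * J (Fin n) ℝ = -(J (Fin n) ℝ * A) := by
  change A ∈ skewAdjointMatricesLieSubalgebra (J (Fin n) ℝ) ↔ _
  rw [mem_skewAdjointMatricesLieSubalgebra, mem_skewAdjointMatricesSubmodule]
  simp only [Matrix.IsSkewAdjoint, Matrix.IsAdjointPair, Matrix.mul_neg]

theorem mem_sp_iff_form (A : Mat n) : A ∈ LieAlgebra.Symplectic.sp (Fin n) ℝ ↔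
    ∀ x y, form (A *ᵥ x) y = -form x (A *ᵥ y) := by
  rw [mem_sp_iff]
  constructor
  · intro h x y
    rw [form_mulVec_left, form_mulVec_right, h, Matrix.neg_mulVec, dotProduct_neg]
  · intro h
    refine eq_of_dotProduct_mulVec fun x y => ?_
    rw [← form_mulVec_left, h, form_mulVec_right, Matrix.neg_mulVec, dotProduct_neg]

theorem mem_symplecticGroup_iff_form (A : Mat n) : A ∈ Matrix.symplecticGroup (Fin n) ℝ ↔
    ∀ x y, form (A *ᵥ x) (A *ᵥ y) = form x y := by
  rw [SymplecticGroup.mem_iff']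
  constructor
  · intro h x y
    rw [form_mulVec_left, Matrix.mulVec_mulVec, h, form]
  · intro h
    refine eq_of_dotProduct_mulVec fun x y => ?_
    rw [← Matrix.mulVec_mulVec, ← form_mulVec_left, h, form]

theorem form_swap (x y : Vec n) : form x y = -form y x := by
  rw [form, dotProduct_comm, ← Matrix.vecMul_transpose, Matrix.J_transpose, Matrix.vecMul_neg,
    neg_dotProduct, ← Matrix.dotProduct_mulVec, form]

theorem isSkewPair_toEnd {A : Mat n} (hA : A ∈ LieAlgebra.Symplectic.sp (Fin n) ℝ) :
    IsSkewPair (bform n) (toEnd A) where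
  alt x := by
    have := form_swap x x
    rw [bform_apply]
    linarith
  skew x y := by
    rw [bform_apply, bform_apply, toEnd_apply, toEnd_apply]
    exact (mem_sp_iff_form A).1 hA x y

theorem form_nondeg {x : Vec n} (hx : ∀ y, form x y = 0) : x = 0 := by
  have := hx (J (Fin n) ℝ *ᵥ x)
  rw [form, Matrix.mulVec_mulVec, Matrix.J_squared, Matrix.neg_mulVec, Matrix.one_mulVec,
    dotProduct_neg, neg_eq_zero] at this
  exact dotProduct_self_eq_zero.1 this

theorem isNondegStable_top (A : Mat n) : IsNondegStable (bform n) (toEnd A) ⊤ :=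
  ⟨fun _ _ => trivial, fun x _ hx => form_nondeg fun y => by rw [← bform_apply]; exact hx y trivial⟩

theorem isotypic_eq (X H Y : SpAlg n) (d : ℕ) : isotypic X H Y d =
    sSup {W | IsIrredEnd (toEnd (X : Mat n)) (toEnd (H : Mat n)) (toEnd (Y : Mat n)) W ∧
      Module.finrank ℝ W = d} := rfl

theorem ker_toEnd (A : Mat n) :
    LinearMap.ker (Matrix.mulVecLin A) = LinearMap.ker (toEnd A) := rfl

end Matrices

/-! ### The partition of row lengths -/

section Partition

theorem card_sigma_fin {t : ℕ → ℕ} {N : ℕ} (hN : ∀ k, N < k → t k = 0) :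
    Nat.card ((d : ℕ) × (Fin (t d) × Fin d)) = ∑ d ∈ Finset.range (N + 1), t d * d := by
  rw [← Nat.card_eq_of_bijective (α := (d : Fin (N + 1)) × (Fin (t d) × Fin d))
    (fun i => ⟨i.1, i.2⟩) ⟨?_, ?_⟩]
  · rw [Nat.card_eq_fintype_card, Fintype.card_sigma, Finset.sum_range]
    simp
  · rintro ⟨⟨d, hd⟩, i⟩ ⟨⟨d', hd'⟩, i'⟩ e
    cases e
    rfl
  · rintro ⟨d, j, l⟩
    have hd : d < N + 1 := by
      by_contra hcon
      have := j.pos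
      have := hN d (by omega)
      omega
    exact ⟨⟨⟨d, hd⟩, j, l⟩, rfl⟩

theorem exists_partition {t : ℕ → ℕ} {N M : ℕ} (h0 : t 0 = 0) (hN : ∀ k, N < k → t k = 0)
    (hM : ∑ d ∈ Finset.range (N + 1), t d * d = M) :
    ∃ P : M.Partition, ∀ d, P.parts.count d = t d := by
  refine ⟨⟨∑ d ∈ Finset.range (N + 1), Multiset.replicate (t d) d, ?_, ?_⟩, fun d => ?_⟩
  · intro i hi
    obtain ⟨d, -, hd⟩ := Multiset.mem_sum.1 hi
    rw [Multiset.mem_replicate] at hd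
    rw [hd.2]
    refine Nat.pos_of_ne_zero fun hd0 => hd.1 ?_
    rw [hd0, h0]
  · rw [← Multiset.coe_sumAddMonoidHom, map_sum, ← hM]
    simp
  · rw [Multiset.count_sum']
    simp only [Multiset.count_replicate]
    rw [Finset.sum_ite_eq' (Finset.range (N + 1)) d t]
    split_ifs with hd
    · rfl
    · rw [Finset.mem_range] at hd
      exact (hN d (by omega)).symm

end Partition

/-! ### Existence of the diagram -/

section Existence

variable {n : ℕ}

theorem IsChainSystem.isAdaptedBasis {X H Y : SpAlg n} {t : ℕ → ℕ} {v : ℕ → ℕ → Vec n}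
    (hC : IsChainSystem (bform n) (toEnd (X : Mat n)) ⊤ t v)
    {B : Module.Basis ((d : ℕ) × (Fin (t d) × Fin d)) ℝ (Vec n)}
    (hB : IsJordanBasis (toEnd (X : Mat n)) (fun d (j : Fin (t d)) => v d j) B)
    (hL : ∀ d (j : Fin (t d)), v d j ∈
      ladder (toEnd (X : Mat n)) (toEnd (H : Mat n)) (toEnd (Y : Mat n)) d)
    (hHY : toEnd (H : Mat n) * toEnd (Y : Mat n) - toEnd (Y : Mat n) * toEnd (H : Mat n) =
      -(2 : ℝ) • toEnd (Y : Mat n)) :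
    IsAdaptedBasis X H Y t fun d j => v d j := by
  have hlow : ∀ d, Submodule.span ℝ (Set.range fun j : Fin (t d) => v d j) = lowest X H Y d := by
    intro d
    rw [lowest, ker_toEnd, isotypic_eq, hB.sSup_irred_eq hL hHY, hB.ker_inf_span_eq hL]
  have hBf : ∀ i, B i = ((X : Mat n) ^ (i.2.2 : ℕ)) *ᵥ v i.1 i.2.1 := by
    rintro ⟨d, j, l⟩
    rw [hB.apply, toEnd_pow_apply]
  have hBf' : (fun i : (d : ℕ) × (Fin (t d) × Fin d) => ((X : Mat n) ^ (i.2.2 : ℕ)) *ᵥ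
      v i.1 i.2.1) = B := funext fun i => (hBf i).symm
  refine ⟨fun d => ?_, hlow, fun d j => ?_, fun d j l hl => ?_, fun d => ?_, ?_, ?_, ?_, ?_, ?_⟩
  · rcases Nat.eq_zero_or_pos d with rfl | hd
    · have : IsEmpty (Fin (t 0)) := by rw [hC.zero]; infer_instance
      exact linearIndependent_empty_type
    · have := B.linearIndependent.comp (fun j : Fin (t d) => ⟨d, j, ⟨0, hd⟩⟩) fun a b e => by
        cases e; rfl
      convert this using 1
      funext j
      rw [Function.comp_apply, hB.apply, pow_zero, Module.End.one_apply]
  · rw [← toEnd_pow_apply]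
    exact hB.pow_eq_zero d j
  · have := ((hL d j).2 l hl).1
    rwa [toEnd_pow_apply, toEnd_apply] at this
  · rw [isotypic_eq, hB.sSup_irred_eq hL hHY]
    simp only [toEnd_pow_apply]
  · rw [hBf']
    exact B.linearIndependent
  · rw [hBf', B.span_eq]
  · intro d d' j j' l l' _ _ hne
    rw [← toEnd_pow_apply, ← toEnd_pow_apply, ← bform_apply] at hne
    exact hC.gram_pow (isSkewPair_toEnd X.2) j.2 j'.2 hne
  · intro d hd j
    rw [← toEnd_pow_apply, ← bform_apply]
    exact hC.norm_even d hd j j.2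
  · intro d hd j j' hj
    rw [← toEnd_pow_apply, ← bform_apply]
    exact hC.norm_odd d hd j j.2 j' j'.2 hj

/-- `IsSl2Triple` requires `H ≠ 0`. By the relations, `H = 0` forces `X = 0`, and `X = 0` forces the
zero triple. -/
theorem isTriple_of_relations {X H Y : SpAlg n}
    (h1 : (H : Mat n) * (X : Mat n) - (X : Mat n) * (H : Mat n) = (2 : ℝ) • (X : Mat n))
    (h2 : (H : Mat n) * (Y : Mat n) - (Y : Mat n) * (H : Mat n) = -(2 : ℝ) • (Y : Mat n))
    (h3 : (X : Mat n) * (Y : Mat n) - (Y : Mat n) * (X : Mat n) = (H : Mat n)) :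
    IsTriple X H Y := by
  by_cases hX : X = 0
  · subst hX
    have hH : H = 0 := Subtype.ext (by rw [← h3]; simp)
    subst hH
    refine Or.inr ⟨rfl, rfl, Subtype.ext ?_⟩
    simpa using h2
  · refine Or.inl ⟨?_, Subtype.ext ?_, Subtype.ext ?_, Subtype.ext ?_⟩
    · rintro rfl
      apply hX
      refine Subtype.ext ?_
      have h1' : (2 : ℝ) • (X : Mat n) = 0 := by rw [← h1]; simp
      exact (smul_eq_zero.1 h1').resolve_left two_ne_zero
    · exact h3
    · change (H : Mat n) * (X : Mat n) - (X : Mat n) * (H : Mat n) = 2 • (X : Mat n)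
      rw [h1, two_smul, two_smul]
    · change (H : Mat n) * (Y : Mat n) - (Y : Mat n) * (H : Mat n) = -(2 • (Y : Mat n))
      rw [h2, neg_smul, two_smul, two_smul]

theorem exists_isDiagramOf (X : SpAlg n) (hX : IsNilpotent (X : Mat n)) :
    ∃ D : SignedYoungDiagram (2 * n), IsDiagramOf X D := by
  obtain ⟨N, hN⟩ := hX
  have hs := isSkewPair_toEnd X.2
  obtain ⟨t, v, hC, ht⟩ := exists_chainSystem hs N ⊤ (isNondegStable_top _) fun x _ => by
    rw [toEnd_pow_apply, hN, Matrix.zero_mulVec]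
  obtain ⟨B, hB⟩ := hC.exists_basis hs
  obtain ⟨H', Y', hL, h1, h2, h3⟩ := hB.exists_triple
  obtain ⟨H, rfl⟩ : ∃ H : SpAlg n, H' = toEnd (H : Mat n) := by
    obtain ⟨A, rfl⟩ : ∃ A : Mat n, toEnd A = H' := Matrix.toLinAlgEquiv'.surjective H'
    refine ⟨⟨A, (mem_sp_iff_form A).2 fun x y => ?_⟩, rfl⟩
    have := hC.skew_H hs hB hL x y
    rwa [bform_apply, bform_apply, toEnd_apply, toEnd_apply] at this
  obtain ⟨Y, rfl⟩ : ∃ Y : SpAlg n, Y' = toEnd (Y : Mat n) := by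
    obtain ⟨A, rfl⟩ : ∃ A : Mat n, toEnd A = Y' := Matrix.toLinAlgEquiv'.surjective Y'
    refine ⟨⟨A, (mem_sp_iff_form A).2 fun x y => ?_⟩, rfl⟩
    have := hC.skew_Y hs hB hL x y
    rwa [bform_apply, bform_apply, toEnd_apply, toEnd_apply] at this
  have hA := hC.isAdaptedBasis hB hL h2
  have hcard := Module.finrank_eq_nat_card_basis B
  rw [card_sigma_fin ht, Module.finrank_fintype_fun_eq_card, Fintype.card_sum,
    Fintype.card_fin, ← two_mul] at hcard
  obtain ⟨P, hP⟩ := exists_partition hC.zero ht hcard.symm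
  have hle : ∀ d, Nat.card {j : Fin (t d) //
      form (v d j) (((X : Mat n) ^ (d - 1)) *ᵥ v d j) = 1} ≤ t d := fun d => by
    rw [Nat.card_eq_fintype_card]
    exact (Fintype.card_subtype_le _).trans_eq (Fintype.card_fin _)
  obtain ⟨D, hD, hDp, hDq⟩ : ∃ D : SignedYoungDiagram (2 * n), D.mult = t ∧
      (∀ d, Even d → D.p d = Nat.card {j : Fin (t d) //
        form (v d j) (((X : Mat n) ^ (d - 1)) *ᵥ v d j) = 1}) ∧ ∀ d, Odd d → D.q d = 0 := by
    classical
    let p : ℕ → ℕ := fun d => if Even d then Nat.card {j : Fin (t d) //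
        form (v d j) (((X : Mat n) ^ (d - 1)) *ᵥ v d j) = 1} else t d
    have hp : ∀ d, p d ≤ t d := fun d => by
      change ite _ _ _ ≤ _
      split_ifs
      exacts [hle d, le_rfl]
    refine ⟨⟨P, p, fun d => t d - p d, fun d => ?_⟩, funext hP, fun d hd => if_pos hd,
      fun d hd => ?_⟩
    · rw [hP, Nat.add_sub_cancel' (hp d)]
    · change t d - ite _ _ _ = 0
      rw [if_neg (Nat.not_even_iff_odd.2 hd), Nat.sub_self]
  subst hD
  refine ⟨D, H, Y, isTriple_of_relations ?_ ?_ ?_, fun d => ?_, fun d j => v d j, hA, hDp, hDq⟩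
  · exact toEnd_injective (by simpa [toEnd] using h1)
  · exact toEnd_injective (by simpa only [toEnd, map_sub, map_mul, map_smul] using h2)
  · exact toEnd_injective (by simpa [toEnd] using h3)
  · rw [← hA.span_lowest d, finrank_span_eq_card (hA.linearIndependent_lowest d), Fintype.card_fin]

end Existence

/-! ### Multiplicities and signatures as invariants of `X` -/

section Invariants

variable {V : Type*} [AddCommGroup V] [Module ℝ V]

namespace IsJordanBasis

variable {X : Module.End ℝ V} {t : ℕ → ℕ} {v : (d : ℕ) → Fin (t d) → V}
  {B : Module.Basis ((d : ℕ) × (Fin (t d) × Fin d)) ℝ V} (hB : IsJordanBasis X v B)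
include hB

omit hB in
theorem finrank_le_of_coord {d : ℕ} (hd : 0 < d) (P : Submodule ℝ V) (S : Set (Fin (t d)))
    (hP : ∀ x ∈ P, (∀ j ∈ S, B.repr x ⟨d, j, ⟨0, hd⟩⟩ = 0) → x = 0) :
    Module.finrank ℝ P ≤ Nat.card S := by
  classical
  let f : P →ₗ[ℝ] (S → ℝ) := LinearMap.pi fun j => B.coord ⟨d, j, ⟨0, hd⟩⟩ ∘ₗ P.subtype
  have hf : Function.Injective f := by
    rw [injective_iff_map_eq_zero]
    intro x hx
    exact Subtype.ext (hP x x.2 fun j hj => congrFun hx ⟨j, hj⟩)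
  have := LinearMap.finrank_le_finrank_of_injective hf
  rwa [Module.finrank_fintype_fun_eq_card, ← Nat.card_eq_fintype_card] at this

theorem linearIndependent_row {d : ℕ} (hd : 0 < d) : LinearIndependent ℝ (v d) := by
  have := B.linearIndependent.comp (fun j : Fin (t d) => ⟨d, j, ⟨0, hd⟩⟩) fun a b e => by
    cases e; rfl
  convert this using 1
  funext j
  rw [Function.comp_apply, hB.apply, pow_zero, Module.End.one_apply]

/-- In `ker X ^ d`, longer chains contribute nothing at their bottoms, shorter ones lie in `ker X ^
(d - 1)`, and everything above a bottom is in `range X`. Together with `eq_zero_of_mem_sup`: the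
bottoms of the rows of length `d` are a basis of `ker X ^ d` modulo these two subspaces. -/
theorem mem_of_pow_eq_zero {d : ℕ} (hd : 0 < d) {x : V} (hx : (X ^ d) x = 0)
    (hc : ∀ j, B.repr x ⟨d, j, ⟨0, hd⟩⟩ = 0) :
    x ∈ LinearMap.ker (X ^ (d - 1)) ⊔ LinearMap.range X := by
  have : x ∈ Submodule.span ℝ (B '' {i | B.repr x i ≠ 0}) := by
    rw [B.mem_span_image]
    intro i hi
    exact Finsupp.mem_support_iff.1 hi
  refine Submodule.span_le.2 ?_ this
  rintro _ ⟨⟨d', j, ⟨l, hl⟩⟩, hi, rfl⟩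
  rw [hB.apply]
  rcases Nat.eq_zero_or_pos l with rfl | hl0
  · refine Submodule.mem_sup_left ?_
    rw [LinearMap.mem_ker, pow_zero, Module.End.one_apply]
    refine pow_apply_eq_zero_of_le (d := d') ?_ (hB.pow_eq_zero d' j)
    rcases lt_trichotomy d' d with h' | rfl | h'
    · omega
    · exact absurd (hc j) hi
    · exfalso
      apply hi
      have := hB.repr_pow d x d' j ⟨d, h'⟩ le_rfl
      rw [hx, map_zero, Finsupp.zero_apply] at this
      simp only [Nat.sub_self] at this
      exact this.symm
  · refine Submodule.mem_sup_right ⟨(X ^ (l - 1)) (v d' j), ?_⟩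
    rw [← Module.End.mul_apply, ← pow_succ', Nat.sub_add_cancel hl0]

theorem eq_zero_of_mem_span {d : ℕ} (hd : 0 < d) {x : V}
    (hx : x ∈ Submodule.span ℝ (Set.range (v d)))
    (hx' : ∀ j, B.repr x ⟨d, j, ⟨0, hd⟩⟩ = 0) : x = 0 := by
  by_contra h0
  obtain ⟨_, j, hj⟩ := hB.exists_repr_ne_zero hx h0
  exact hj (hx' j)

theorem eq_zero_of_mem_sup {d : ℕ} (hd : 0 < d) {x : V}
    (hx : x ∈ Submodule.span ℝ (Set.range (v d)))
    (hx' : x ∈ LinearMap.ker (X ^ (d - 1)) ⊔ LinearMap.range X) : x = 0 := by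
  refine hB.eq_zero_of_mem_span hd hx fun j => ?_
  obtain ⟨a, ha, _, ⟨s, rfl⟩, rfl⟩ := Submodule.mem_sup.1 hx'
  have h1 := hB.repr_pow (d - 1) (a + X s) d j ⟨d - 1, by omega⟩ le_rfl
  simp only [Nat.sub_self] at h1
  rw [← h1, map_add, LinearMap.mem_ker.1 ha, zero_add, ← Module.End.mul_apply, ← pow_succ]
  exact hB.repr_pow_of_lt _ _ _ _ _ (by simp only; omega)

theorem row_mem_ker (d : ℕ) : Submodule.span ℝ (Set.range (v d)) ≤ LinearMap.ker (X ^ d) := by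
  rw [Submodule.span_le]
  rintro _ ⟨j, rfl⟩
  exact hB.pow_eq_zero d j

/-- The multiplicities of the row lengths depend on `X` only. -/
theorem mult_le {t' : ℕ → ℕ} {v' : (d : ℕ) → Fin (t' d) → V}
    {B' : Module.Basis ((d : ℕ) × (Fin (t' d) × Fin d)) ℝ V} (hB' : IsJordanBasis X v' B')
    {d : ℕ} (hd : 0 < d) : t' d ≤ t d := by
  have h1 := finrank_span_eq_card (hB'.linearIndependent_row hd)
  have h2 := finrank_le_of_coord (B := B) hd (Submodule.span ℝ (Set.range (v' d))) Set.univ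
    fun x hx hx' => hB'.eq_zero_of_mem_sup hd hx
      (hB.mem_of_pow_eq_zero hd (hB'.row_mem_ker d hx) fun j => hx' j trivial)
  rw [h1, Fintype.card_fin, Nat.card_eq_fintype_card, Fintype.card_setUniv, Fintype.card_fin] at h2
  exact h2

variable {ω : LinearMap.BilinForm ℝ V} (h : IsSkewPair ω X) {d : ℕ} (hd : 0 < d)
  (ho : ∀ i j, i ≠ j → ω (v d i) ((X ^ (d - 1)) (v d j)) = 0)
include h hd ho

/-- Vectors of `ker X ^ d` lying in `ker X ^ (d - 1) ⊔ range X` are in the radical of the twisted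
form on `ker X ^ d`, so `x` may be replaced by its component along the bottoms of the rows of length
`d`, where the form is diagonal. -/
theorem form_pow_eq_sum {x : V} (hx : (X ^ d) x = 0) :
    ω x ((X ^ (d - 1)) x) = ∑ j, B.repr x ⟨d, j, ⟨0, hd⟩⟩ ^ 2 *
      ω (v d j) ((X ^ (d - 1)) (v d j)) := by
  set y : V := ∑ j, B.repr x ⟨d, j, ⟨0, hd⟩⟩ • v d j with hy
  have hyd : (X ^ d) y = 0 := by
    rw [hy, map_sum]
    exact Finset.sum_eq_zero fun j _ => by rw [map_smul, hB.pow_eq_zero, smul_zero]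
  have hr : x - y ∈ LinearMap.ker (X ^ (d - 1)) ⊔ LinearMap.range X := by
    refine hB.mem_of_pow_eq_zero hd (by rw [map_sub, hx, hyd, sub_zero]) fun j => ?_
    have h1 : ∀ k, B.repr (v d k) ⟨d, j, ⟨0, hd⟩⟩ = if j = k then 1 else 0 := fun k => by
      have := hB.repr_chain d d j k ⟨0, hd⟩ 0
      rw [pow_zero, Module.End.one_apply] at this
      rw [this]
      simp
    rw [map_sub, Finsupp.sub_apply, hy, map_sum, Finsupp.finsetSum_apply]
    simp [h1]
  have hz : ∀ z, (X ^ d) z = 0 → ω (x - y) ((X ^ (d - 1)) z) = 0 := by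
    intro z hz
    obtain ⟨a, ha, _, ⟨s, rfl⟩, hxy⟩ := Submodule.mem_sup.1 hr
    have h2 : ω a ((X ^ (d - 1)) z) = 0 := by
      rw [h.pow_symm, h.swap, LinearMap.mem_ker.1 ha]
      simp
    rw [← hxy, map_add, LinearMap.add_apply, h2, h.skew, ← Module.End.mul_apply, ← pow_succ',
      Nat.sub_add_cancel hd, hz]
    simp
  have h3 : ω x ((X ^ (d - 1)) x) = ω y ((X ^ (d - 1)) y) := by
    have e1 := hz x hx
    have e2 := hz y hyd
    rw [h.pow_symm] at e2
    have e3 : ω y ((X ^ (d - 1)) (x - y)) = 0 := by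
      simpa using e2
    rw [map_sub, LinearMap.sub_apply] at e1
    rw [map_sub, map_sub] at e3
    linarith
  rw [h3, hy, map_sum, map_sum, LinearMap.sum_apply]
  refine Finset.sum_congr rfl fun i _ => ?_
  rw [map_sum, Finset.sum_eq_single i]
  · rw [map_smul, map_smul, LinearMap.smul_apply, map_smul, smul_eq_mul, smul_eq_mul]
    ring
  · intro j _ hj
    rw [map_smul, map_smul, LinearMap.smul_apply, map_smul, ho i j hj.symm]
    simp
  · simp

variable (hε : ∀ j, ω (v d j) ((X ^ (d - 1)) (v d j)) = 1 ∨ ω (v d j) ((X ^ (d - 1)) (v d j)) = -1)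
  {s : ℝ} (hs : s = 1 ∨ s = -1)
include hε hs

/-- A definite subspace of `ker X ^ d` has dimension at most the number of rows of length `d` of
the given sign. -/
theorem finrank_le_of_definite (P : Submodule ℝ V) (hP : P ≤ LinearMap.ker (X ^ d))
    (hdef : ∀ x ∈ P, x ≠ 0 → 0 < s * ω x ((X ^ (d - 1)) x)) :
    Module.finrank ℝ P ≤ Nat.card {j // ω (v d j) ((X ^ (d - 1)) (v d j)) = s} := by
  refine finrank_le_of_coord (B := B) hd P {j | ω (v d j) ((X ^ (d - 1)) (v d j)) = s}
    fun x hx hx' => ?_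
  by_contra h0
  have h1 := hdef x hx h0
  rw [hB.form_pow_eq_sum h hd ho (hP hx), Finset.mul_sum] at h1
  -- If the coordinates of sign `s` vanish, only terms of the opposite sign remain, contradicting
  -- definiteness.
  refine absurd h1 (not_lt.2 (Finset.sum_nonpos fun j _ => ?_))
  by_cases hj : ω (v d j) ((X ^ (d - 1)) (v d j)) = s
  · rw [hx' j hj]
    simp
  · have h2 : s * ω (v d j) ((X ^ (d - 1)) (v d j)) = -1 := by
      rcases hε j with h' | h' <;> rcases hs with rfl | rfl <;> rw [h'] at hj ⊢ <;>
        first | exact absurd rfl hj | norm_num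
    nlinarith [sq_nonneg (B.repr x ⟨d, j, ⟨0, hd⟩⟩)]

omit hε in
-- The bound of `finrank_le_of_definite` is attained by the span of the bottoms of sign `s`.
theorem exists_definite : ∃ P : Submodule ℝ V, P ≤ LinearMap.ker (X ^ d) ∧
    (∀ x ∈ P, x ≠ 0 → 0 < s * ω x ((X ^ (d - 1)) x)) ∧
    Module.finrank ℝ P = Nat.card {j // ω (v d j) ((X ^ (d - 1)) (v d j)) = s} := by
  classical
  set S : Set (Fin (t d)) := {j | ω (v d j) ((X ^ (d - 1)) (v d j)) = s} with hS
  have hle : Submodule.span ℝ (Set.range fun j : S => v d j) ≤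
      Submodule.span ℝ (Set.range (v d)) := by
    refine Submodule.span_mono ?_
    rintro _ ⟨j, rfl⟩
    exact ⟨j, rfl⟩
  refine ⟨Submodule.span ℝ (Set.range fun j : S => v d j), hle.trans (hB.row_mem_ker d),
    fun x hx hx0 => ?_, ?_⟩
  · obtain ⟨_, j₀, hj₀⟩ := hB.exists_repr_ne_zero (hle hx) hx0
    have hz : ∀ j ∉ S, B.repr x ⟨d, j, ⟨0, hd⟩⟩ = 0 := by
      intro j hj
      have : Submodule.span ℝ (Set.range fun j : S => v d j) ≤
          LinearMap.ker (B.coord ⟨d, j, ⟨0, hd⟩⟩) := by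
        rw [Submodule.span_le]
        rintro _ ⟨k, rfl⟩
        have := hB.repr_chain d d j k ⟨0, hd⟩ 0
        rw [pow_zero, Module.End.one_apply] at this
        rw [SetLike.mem_coe, LinearMap.mem_ker, Module.Basis.coord_apply, this, if_neg]
        rintro ⟨e, -⟩
        cases e
        exact hj k.2
      exact this hx
    have hss : s * s = 1 := by rcases hs with rfl | rfl <;> norm_num
    rw [hB.form_pow_eq_sum h hd ho (hB.row_mem_ker d (hle hx)), Finset.mul_sum]
    have hterm : ∀ j, s * (B.repr x ⟨d, j, ⟨0, hd⟩⟩ ^ 2 *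
        ω (v d j) ((X ^ (d - 1)) (v d j))) = B.repr x ⟨d, j, ⟨0, hd⟩⟩ ^ 2 := by
      intro j
      by_cases hj : j ∈ S
      · rw [show ω (v d j) ((X ^ (d - 1)) (v d j)) = s from hj, mul_left_comm, hss, mul_one]
      · rw [hz j hj]
        simp
    simp only [hterm]
    exact Finset.sum_pos' (fun j _ => sq_nonneg _)
      ⟨j₀, Finset.mem_univ _, by positivity⟩
  · have := finrank_span_eq_card (R := ℝ) ((hB.linearIndependent_row hd).comp
      (Subtype.val : S → Fin (t d)) Subtype.val_injective)
    rw [← Nat.card_eq_fintype_card] at this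
    exact this

end IsJordanBasis

end Invariants

/-! ### The involution that reverses `X` -/

section Twist

variable {V : Type*} [AddCommGroup V] [Module ℝ V] {X : Module.End ℝ V} {t : ℕ → ℕ}
  {v : (d : ℕ) → Fin (t d) → V}
  {B : Module.Basis ((d : ℕ) × (Fin (t d) × Fin d)) ℝ V}

/-- An involution of the rows extends to an involution anticommuting with `X`. -/
theorem IsJordanBasis.exists_twist (hB : IsJordanBasis X v B) (σ : (d : ℕ) → Fin (t d) → Fin (t d))
    (hσ : ∀ d j, σ d (σ d j) = j) : ∃ T : Module.End ℝ V, T * T = 1 ∧ T * X = -(X * T) ∧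
      ∀ d j (l : ℕ), T ((X ^ l) (v d j)) = (-1 : ℝ) ^ l • (X ^ l) (v d (σ d j)) := by
  -- The sign `(-1) ^ l` makes `T` anticommute with `X`; it squares away in `T * T`.
  set T : Module.End ℝ V := B.constr ℝ fun i =>
    (-1 : ℝ) ^ (i.2.2 : ℕ) • (X ^ (i.2.2 : ℕ)) (v i.1 (σ i.1 i.2.1)) with hT
  have key : ∀ d j (l : ℕ), T ((X ^ l) (v d j)) = (-1 : ℝ) ^ l • (X ^ l) (v d (σ d j)) := by
    intro d j l
    by_cases hl : l < d
    · have := hB.apply d j ⟨l, hl⟩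
      simp only at this
      rw [← this, hT, B.constr_basis]
    · rw [pow_apply_eq_zero_of_le (not_lt.1 hl) (hB.pow_eq_zero d j), map_zero,
        pow_apply_eq_zero_of_le (not_lt.1 hl) (hB.pow_eq_zero d _), smul_zero]
  refine ⟨T, B.ext ?_, B.ext ?_, key⟩
  · rintro ⟨d, j, l⟩
    rw [hB.apply, Module.End.mul_apply, key, map_smul, key, hσ, smul_smul, ← pow_add,
      (Even.add_self _).neg_one_pow, one_smul, Module.End.one_apply]
  · rintro ⟨d, j, l⟩
    rw [hB.apply, Module.End.mul_apply, LinearMap.neg_apply, Module.End.mul_apply,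
      ← Module.End.mul_apply X, ← pow_succ', key, key, map_smul, ← Module.End.mul_apply X,
      ← pow_succ', ← neg_smul, pow_succ]
    simp

end Twist

theorem exists_swap {α : Type*} [Finite α] {P : α → Prop}
    (h : Nat.card {a // P a} = Nat.card {a // ¬P a}) :
    ∃ σ : α → α, (∀ a, σ (σ a) = a) ∧ ∀ a, P (σ a) ↔ ¬P a := by
  classical
  obtain ⟨e⟩ : Nonempty ({a // P a} ≃ {a // ¬P a}) := Finite.card_eq.1 h
  refine ⟨fun a => if ha : P a then e ⟨a, ha⟩ else e.symm ⟨a, ha⟩, fun a => ?_, fun a => ?_⟩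
  · by_cases ha : P a
    · have h2 := (e ⟨a, ha⟩).2
      simp [ha, h2]
    · have h2 := (e.symm ⟨a, ha⟩).2
      simp [ha, h2]
  · by_cases ha : P a
    · have h2 := (e ⟨a, ha⟩).2
      simp [ha, h2]
    · have h2 := (e.symm ⟨a, ha⟩).2
      simp [ha, h2]

/-! ### Uniqueness of the diagram and reality in the Lie algebra -/

section Main

variable {n : ℕ} {X H Y : SpAlg n} {t : ℕ → ℕ} {v : (d : ℕ) → Fin (t d) → Vec n}

theorem IsAdaptedBasis.exists_basis (hA : IsAdaptedBasis X H Y t v) :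
    ∃ B : Module.Basis ((d : ℕ) × (Fin (t d) × Fin d)) ℝ (Vec n),
      IsJordanBasis (toEnd (X : Mat n)) v B := by
  refine ⟨Module.Basis.mk hA.linearIndependent hA.span_eq_top.ge, fun d j l => ?_, fun d j => ?_⟩
  · rw [Module.Basis.mk_apply, toEnd_pow_apply]
  · rw [toEnd_pow_apply, hA.pow_eq_zero]

theorem IsAdaptedBasis.row_ortho (hA : IsAdaptedBasis X H Y t v) {d : ℕ} (hd : 0 < d)
    (hd' : Even d) (i j : Fin (t d)) (hij : i ≠ j) :
    bform n (v d i) ((toEnd (X : Mat n) ^ (d - 1)) (v d j)) = 0 := by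
  rw [bform_apply, toEnd_pow_apply]
  by_contra hne
  have := hA.orthogonal d d i j 0 (d - 1) hd (by omega) (by rwa [pow_zero, Matrix.one_mulVec])
  rcases this.2.2 with h1 | h1
  · exact hij (Fin.ext h1.2)
  · exact absurd hd' (Nat.not_even_iff_odd.2 h1.1)

theorem IsAdaptedBasis.row_norm (hA : IsAdaptedBasis X H Y t v) {d : ℕ} (hd : Even d)
    (j : Fin (t d)) : bform n (v d j) ((toEnd (X : Mat n) ^ (d - 1)) (v d j)) = 1 ∨
      bform n (v d j) ((toEnd (X : Mat n) ^ (d - 1)) (v d j)) = -1 := by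
  rw [bform_apply, toEnd_pow_apply]
  exact hA.norm_even d hd j

/-- The number of rows of length `d` with sign `s`. -/
def signCount (X : SpAlg n) (v : (d : ℕ) → Fin (t d) → Vec n) (d : ℕ) (s : ℝ) : ℕ :=
  Nat.card {j // bform n (v d j) ((toEnd (X : Mat n) ^ (d - 1)) (v d j)) = s}

theorem signCount_eq (X : SpAlg n) (v : (d : ℕ) → Fin (t d) → Vec n) (d : ℕ) (s : ℝ) :
    signCount X v d s =
      Nat.card {j : Fin (t d) // form (v d j) (((X : Mat n) ^ (d - 1)) *ᵥ v d j) = s} := by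
  simp only [signCount, bform_apply, toEnd_pow_apply]

theorem IsAdaptedBasis.signCount_neg_one (hA : IsAdaptedBasis X H Y t v) {d : ℕ} (hd : Even d) :
    signCount X v d (-1) =
      Nat.card {j // ¬bform n (v d j) ((toEnd (X : Mat n) ^ (d - 1)) (v d j)) = 1} := by
  refine Nat.card_congr (Equiv.subtypeEquivRight fun j => ?_)
  rcases hA.row_norm hd j with h | h <;> rw [h] <;> norm_num

theorem IsAdaptedBasis.signCount_add (hA : IsAdaptedBasis X H Y t v) {d : ℕ} (hd : Even d) :
    signCount X v d 1 + signCount X v d (-1) = t d := by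
  classical
  rw [hA.signCount_neg_one hd, signCount, Nat.card_eq_fintype_card, Nat.card_eq_fintype_card,
    Fintype.card_subtype_compl, Fintype.card_fin]
  refine Nat.add_sub_cancel' ?_
  exact (Fintype.card_subtype_le _).trans_eq (Fintype.card_fin _)

/-- Carries a maximal definite subspace along `g` and applies the bound in the other basis. It is
used with `g = 1` to compare two adapted bases, and with an element conjugating `X` to `-X`, where
`r = -s`, to compare `p_d` with `q_d`. -/
theorem IsAdaptedBasis.signCount_le_of_map (hA : IsAdaptedBasis X H Y t v) {H' Y' : SpAlg n}
    {t' : ℕ → ℕ} {v' : (d : ℕ) → Fin (t' d) → Vec n} (hA' : IsAdaptedBasis X H' Y' t' v')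
    {d : ℕ} (hd : 0 < d) (hd' : Even d) {s r : ℝ} (hs : s = 1 ∨ s = -1) (hr : r = 1 ∨ r = -1)
    (g : Module.End ℝ (Vec n)) (hg : Function.Injective g)
    (hgk : ∀ x, (toEnd (X : Mat n) ^ d) x = 0 → (toEnd (X : Mat n) ^ d) (g x) = 0)
    (hgf : ∀ x, r * bform n (g x) ((toEnd (X : Mat n) ^ (d - 1)) (g x)) =
      s * bform n x ((toEnd (X : Mat n) ^ (d - 1)) x)) :
    signCount X v d s ≤ signCount X v' d r := by
  obtain ⟨B, hB⟩ := hA.exists_basis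
  obtain ⟨B', hB'⟩ := hA'.exists_basis
  have hX := isSkewPair_toEnd X.2
  obtain ⟨P, hP, hPd, hPr⟩ := hB.exists_definite hX hd (hA.row_ortho hd hd') hs
  have := hB'.finrank_le_of_definite hX hd (hA'.row_ortho hd hd') (hA'.row_norm hd') hr (P.map g)
    ?_ ?_
  · rwa [← (Submodule.equivMapOfInjective g hg P).finrank_eq, hPr] at this
  · rintro _ ⟨x, hx, rfl⟩
    exact hgk x (hP hx)
  · rintro _ ⟨x, hx, rfl⟩ hx0
    rw [hgf]
    refine hPd x hx ?_
    rintro rfl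
    exact hx0 (map_zero g)

theorem SignedYoungDiagram.mult_zero {N : ℕ} (D : SignedYoungDiagram N) : D.mult 0 = 0 :=
  Multiset.count_eq_zero.2 fun h => absurd (D.shape.parts_pos h) (lt_irrefl 0)

theorem SignedYoungDiagram.ext' {N : ℕ} {D D' : SignedYoungDiagram N}
    (h1 : ∀ d, D.mult d = D'.mult d) (h2 : ∀ d, D.p d = D'.p d) : D = D' := by
  obtain ⟨P, p, q, h⟩ := D
  obtain ⟨P', p', q', h'⟩ := D'
  obtain rfl : P = P' := Nat.Partition.ext (Multiset.ext.2 h1)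
  obtain rfl : p = p' := funext h2
  obtain rfl : q = q' := funext fun d => by
    have a := h d
    have b := h' d
    omega
  rfl

theorem isDiagramOf_unique {X : SpAlg n} {D D' : SignedYoungDiagram (2 * n)}
    (hD : IsDiagramOf X D) (hD' : IsDiagramOf X D') : D = D' := by
  obtain ⟨H, Y, -, -, v, hA, hp, hq⟩ := hD
  obtain ⟨H', Y', -, -, v', hA', hp', hq'⟩ := hD'
  obtain ⟨B, hB⟩ := hA.exists_basis
  obtain ⟨B', hB'⟩ := hA'.exists_basis
  have hm : ∀ d, D.mult d = D'.mult d := fun d => by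
    rcases Nat.eq_zero_or_pos d with rfl | hd
    · rw [D.mult_zero, D'.mult_zero]
    · exact le_antisymm (hB'.mult_le hB hd) (hB.mult_le hB' hd)
  refine SignedYoungDiagram.ext' hm fun d => ?_
  have e1 := D.p_add_q d
  have e2 := D'.p_add_q d
  have e3 := hm d
  rw [SignedYoungDiagram.mult, SignedYoungDiagram.mult] at e3
  rcases Nat.eq_zero_or_pos d with rfl | hd
  · have := D.mult_zero
    rw [SignedYoungDiagram.mult] at this
    omega
  rcases Nat.even_or_odd d with hd' | hd'
  · rw [hp d hd', hp' d hd', ← signCount_eq, ← signCount_eq]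
    exact le_antisymm
      (hA.signCount_le_of_map hA' hd hd' (Or.inl rfl) (Or.inl rfl) 1 Function.injective_id
        (fun _ hx => hx) fun _ => rfl)
      (hA'.signCount_le_of_map hA hd hd' (Or.inl rfl) (Or.inl rfl) 1 Function.injective_id
        (fun _ hx => hx) fun _ => rfl)
  · have := hq d hd'
    have := hq' d hd'
    omega

theorem coe_inv_mul (g : SpGroup n) : ((g⁻¹ : SpGroup n) : Mat n) * (g : Mat n) = 1 := by
  rw [← Submonoid.coe_mul, inv_mul_cancel, Submonoid.coe_one]

theorem coe_mul_inv (g : SpGroup n) : (g : Mat n) * ((g⁻¹ : SpGroup n) : Mat n) = 1 := by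
  rw [← Submonoid.coe_mul, mul_inv_cancel, Submonoid.coe_one]

theorem eq_ad_iff (g : SpGroup n) (X Z : SpAlg n) :
    Z = Ad g X ↔ (Z : Mat n) * (g : Mat n) = (g : Mat n) * (X : Mat n) := by
  rw [← Subtype.coe_inj]
  change (Z : Mat n) = (g : Mat n) * (X : Mat n) * ((g⁻¹ : SpGroup n) : Mat n) ↔ _
  constructor
  · intro h
    rw [h, Matrix.mul_assoc, coe_inv_mul, Matrix.mul_one]
  · intro h
    rw [← h, Matrix.mul_assoc, coe_mul_inv, Matrix.mul_one]

/-- Anticommutation gives `X ^ (d - 1) g = -g X ^ (d - 1)` for even `d`, so `g` exchanges positive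
and negative definite subspaces of the twisted form. -/
theorem isBalanced_of_isAdReal {X : SpAlg n} {D : SignedYoungDiagram (2 * n)}
    (hD : IsDiagramOf X D) (hX : IsAdReal X) : D.IsBalanced := by
  intro d hdD hd'
  have hd : 0 < d := D.shape.parts_pos hdD
  obtain ⟨g, hg⟩ := hX
  have hg' := (eq_ad_iff g X (-X)).1 hg.symm
  have hcomm : toEnd (g : Mat n) * toEnd (X : Mat n) = -(toEnd (X : Mat n) * toEnd (g : Mat n)) := by
    rw [toEnd, toEnd, ← map_mul, ← map_mul, ← map_neg, ← hg']
    congr 1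
    exact Matrix.neg_mul _ _
  have hpow : ∀ k x, (toEnd (X : Mat n) ^ k) (toEnd (g : Mat n) x) =
      (-1 : ℝ) ^ k • toEnd (g : Mat n) ((toEnd (X : Mat n) ^ k) x) := by
    intro k x
    induction k with
    | zero => simp
    | succ k ih =>
      have h1 : ∀ y, toEnd (X : Mat n) (toEnd (g : Mat n) y) =
          -toEnd (g : Mat n) (toEnd (X : Mat n) y) := fun y => by
        have := LinearMap.congr_fun hcomm y
        rw [LinearMap.neg_apply, Module.End.mul_apply, Module.End.mul_apply] at this
        rw [this, neg_neg]
      rw [pow_succ', Module.End.mul_apply, ih, map_smul, h1, pow_succ', Module.End.mul_apply,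
        smul_neg, neg_one_mul, neg_smul]
  have hinj : Function.Injective (toEnd (g : Mat n)) := by
    refine Function.LeftInverse.injective (g := toEnd ((g⁻¹ : SpGroup n) : Mat n)) fun x => ?_
    rw [toEnd_apply, toEnd_apply, Matrix.mulVec_mulVec, coe_inv_mul, Matrix.one_mulVec]
  have hform : ∀ x y, bform n (toEnd (g : Mat n) x) (toEnd (g : Mat n) y) = bform n x y := by
    intro x y
    rw [bform_apply, bform_apply, toEnd_apply, toEnd_apply]
    exact (mem_symplecticGroup_iff_form _).1 g.2 x y
  have hodd : Odd (d - 1) := Nat.Even.sub_odd hd hd' odd_one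
  obtain ⟨H, Y, -, -, v, hA, hp, -⟩ := hD
  have key : ∀ s : ℝ, s = 1 ∨ s = -1 → signCount X v d s ≤ signCount X v d (-s) := by
    intro s hs
    refine hA.signCount_le_of_map hA hd hd' hs ?_ (toEnd (g : Mat n)) hinj (fun x hx => ?_)
      fun x => ?_
    · rcases hs with rfl | rfl <;> norm_num
    · rw [hpow, hx, map_zero, smul_zero]
    · rw [hpow, map_smul, hform, hodd.neg_one_pow]
      simp
  have k1 := key 1 (Or.inl rfl)
  have k2 := key (-1) (Or.inr rfl)
  rw [neg_neg] at k2
  have h1 := D.p_add_q d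
  have h2 := hA.signCount_add hd'
  have h3 := hp d hd'
  rw [← signCount_eq] at h3
  rw [SignedYoungDiagram.mult] at h2
  omega

/-- Balance provides an involution of the rows of each even length which reverses signs; its twist
is the required symplectic involution. -/
theorem isStronglyAdReal_of_isBalanced {X : SpAlg n} {D : SignedYoungDiagram (2 * n)}
    (hD : IsDiagramOf X D) (hb : D.IsBalanced) : IsStronglyAdReal X := by
  obtain ⟨H, Y, -, -, v, hA, hp, -⟩ := hD
  obtain ⟨B, hB⟩ := hA.exists_basis
  have hX := isSkewPair_toEnd X.2
  have hex : ∀ d, ∃ σ : Fin (D.mult d) → Fin (D.mult d), (∀ j, σ (σ j) = j) ∧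
      (Even d → ∀ j, bform n (v d (σ j)) ((toEnd (X : Mat n) ^ (d - 1)) (v d (σ j))) =
        -bform n (v d j) ((toEnd (X : Mat n) ^ (d - 1)) (v d j))) ∧
      (Odd d → ∀ j, σ j = j) := by
    intro d
    rcases Nat.even_or_odd d with hd | hd
    · have hpq : signCount X v d 1 = signCount X v d (-1) := by
        have h1 := D.p_add_q d
        have h2 := hA.signCount_add hd
        have h3 := hp d hd
        rw [← signCount_eq] at h3
        rw [SignedYoungDiagram.mult] at h2
        by_cases hdD : d ∈ D.shape.parts
        · have := hb d hdD hd
          omega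
        · rw [Multiset.count_eq_zero.2 hdD] at h2
          omega
      rw [hA.signCount_neg_one hd] at hpq
      obtain ⟨σ, h1, h2⟩ := exists_swap hpq
      refine ⟨σ, h1, fun _ j => ?_, fun h => absurd hd (Nat.not_even_iff_odd.2 h)⟩
      have h3 := h2 j
      rcases hA.row_norm hd j with h | h <;> rcases hA.row_norm hd (σ j) with h' | h' <;>
        rw [h, h'] at h3 ⊢ <;> first | (exfalso; norm_num at h3; done) | norm_num
    · exact ⟨id, fun _ => rfl, fun h => absurd h (Nat.not_even_iff_odd.2 hd), fun _ _ => rfl⟩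
  choose σ hσ hσe hσo using hex
  obtain ⟨T, hT1, hT2, hT⟩ := hB.exists_twist σ hσ
  have hform : ∀ x y, bform n (T x) (T y) = bform n x y := by
    have : (LinearMap.comp (bform n) T).compl₂ T = bform n := by
      refine LinearMap.ext_basis B B ?_
      rintro ⟨d, j, ⟨l, hl⟩⟩ ⟨d', j', ⟨l', hl'⟩⟩
      rw [LinearMap.compl₂_apply, LinearMap.comp_apply, hB.apply, hB.apply, hT, hT, map_smul,
        map_smul, LinearMap.smul_apply, smul_eq_mul, smul_eq_mul]
      simp only
      have horth : ∀ (i : Fin (D.mult d)) (i' : Fin (D.mult d')),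
          bform n ((toEnd (X : Mat n) ^ l) (v d i)) ((toEnd (X : Mat n) ^ l') (v d' i')) ≠ 0 →
          d = d' ∧ l + l' + 1 = d ∧ (Even d → (i : ℕ) = i') := by
        intro i i' hne
        rw [bform_apply, toEnd_pow_apply, toEnd_pow_apply] at hne
        obtain ⟨h1, h2, h3⟩ := hA.orthogonal d d' i i' l l' hl hl' hne
        refine ⟨h1, h2, fun he => ?_⟩
        rcases h3 with h3 | h3
        · exact h3.2
        · exact absurd he (Nat.not_even_iff_odd.2 h3.1)
      by_cases hdd : d = d' ∧ l + l' + 1 = d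
      swap
      · rw [not_imp_comm.1 (horth j j') fun h => hdd ⟨h.1, h.2.1⟩,
          not_imp_comm.1 (horth (σ d j) (σ d' j')) fun h => hdd ⟨h.1, h.2.1⟩]
        simp
      obtain ⟨rfl, hll⟩ := hdd
      -- The combined sign is `(-1) ^ (d - 1)`: it is compensated by `σ` for even `d`, and is `1`
      -- for odd `d`, where `σ` fixes every row.
      rw [← mul_assoc, ← pow_add, add_comm l' l]
      rcases Nat.even_or_odd d with hd | hd
      · have hodd : Odd (l + l') := by
          rw [show l + l' = d - 1 by omega]
          exact Nat.Even.sub_odd (by omega) hd odd_one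
        rw [hodd.neg_one_pow]
        by_cases hjj : j = j'
        · subst hjj
          rw [hX.pow_pow, hX.pow_pow, show l + l' = d - 1 by omega, hσe d hd]
          ring
        · have hjj' : σ d j ≠ σ d j' := fun h => hjj (by rw [← hσ d j, h, hσ])
          rw [not_imp_comm.1 (horth j j') fun h => hjj (Fin.ext (h.2.2 hd)),
            not_imp_comm.1 (horth (σ d j) (σ d j')) fun h => hjj' (Fin.ext (h.2.2 hd)), mul_zero]
      · have heven : Even (l + l') := by
          rw [show l + l' = d - 1 by omega]
          exact Nat.Odd.sub_odd hd odd_one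
        rw [heven.neg_one_pow, hσo d hd, hσo d hd, one_mul]
    exact fun x y => LinearMap.congr_fun₂ this x y
  obtain ⟨A, rfl⟩ : ∃ A : Mat n, toEnd A = T := Matrix.toLinAlgEquiv'.surjective T
  have hAmem : A ∈ Matrix.symplecticGroup (Fin n) ℝ := by
    rw [mem_symplecticGroup_iff_form]
    intro x y
    have := hform x y
    rwa [bform_apply, bform_apply, toEnd_apply, toEnd_apply] at this
  refine ⟨⟨A, hAmem⟩, Subtype.ext ?_, ?_⟩
  · change A ^ 2 = 1
    refine toEnd_injective ?_
    have h1 : toEnd (1 : Mat n) = 1 := map_one Matrix.toLinAlgEquiv'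
    rw [h1, pow_two, toEnd, map_mul]
    exact hT1
  · rw [eq_ad_iff]
    change -(X : Mat n) * A = A * (X : Mat n)
    refine toEnd_injective ?_
    rw [Matrix.neg_mul, toEnd, toEnd, map_neg, map_mul, map_mul]
    exact hT2.symm

theorem tfae_real {X : SpAlg n} {D : SignedYoungDiagram (2 * n)} (hD : IsDiagramOf X D) :
    [IsAdReal X, IsStronglyAdReal X, D.IsBalanced].TFAE := by
  tfae_have 1 → 3 := isBalanced_of_isAdReal hD
  tfae_have 3 → 2 := isStronglyAdReal_of_isBalanced hD
  tfae_have 2 → 1 := fun ⟨τ, _, h⟩ => ⟨τ, h.symm⟩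
  tfae_finish

end Main

/-! ### The exponential of nilpotent matrices -/

section Exp

variable {m : Type*} [Fintype m] [DecidableEq m]

theorem exp_eq_of_pow_eq_zero {X : Matrix m m ℝ} {k : ℕ} (hX : X ^ k = 0) :
    NormedSpace.exp X = ∑ i ∈ Finset.range k, ((i.factorial : ℝ)⁻¹) • X ^ i := by
  rw [NormedSpace.exp_eq_tsum ℝ]
  refine tsum_eq_sum fun i hi => ?_
  rw [pow_eq_zero_of_le (by simpa using hi) hX, smul_zero]

theorem exists_exp_eq {X : Matrix m m ℝ} (hX : IsNilpotent X) :
    ∃ p : Polynomial ℝ, NormedSpace.exp X = 1 + X + X ^ 2 * Polynomial.aeval X p := by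
  obtain ⟨k, hk⟩ := hX
  refine ⟨∑ i ∈ Finset.range k, Polynomial.C (((i + 2).factorial : ℝ)⁻¹) * Polynomial.X ^ i, ?_⟩
  rw [exp_eq_of_pow_eq_zero (k := k + 2) (pow_eq_zero_of_le (by omega) hk),
    Finset.sum_range_succ', Finset.sum_range_succ', map_sum, Finset.mul_sum]
  have : ∀ i, X ^ 2 * Polynomial.aeval X
      (Polynomial.C (((i + 2).factorial : ℝ)⁻¹) * Polynomial.X ^ i) =
        (((i + 1 + 1).factorial : ℝ)⁻¹) • X ^ (i + 1 + 1) := fun i => by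
    rw [map_mul, Polynomial.aeval_C, map_pow, Polynomial.aeval_X, ← Algebra.smul_def,
      mul_smul_comm, ← pow_add, add_comm 2 i]
  simp only [this]
  simp only [zero_add, Nat.factorial_zero, Nat.factorial_one, Nat.cast_one, inv_one, one_smul,
    pow_zero, pow_one]
  abel

theorem exp_neg_mul_exp (X : Matrix m m ℝ) : NormedSpace.exp (-X) * NormedSpace.exp X = 1 := by
  rw [← Matrix.exp_add_of_commute _ _ (Commute.neg_left (Commute.refl X)), neg_add_cancel,
    NormedSpace.exp_zero]

theorem exp_mul_exp_neg (X : Matrix m m ℝ) : NormedSpace.exp X * NormedSpace.exp (-X) = 1 := by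
  simpa using exp_neg_mul_exp (-X)

theorem isNilpotent_exp_sub_one {X : Matrix m m ℝ} (hX : IsNilpotent X) :
    IsNilpotent (NormedSpace.exp X - 1) := by
  obtain ⟨p, hp⟩ := exists_exp_eq hX
  have : NormedSpace.exp X - 1 = X * Polynomial.aeval X (1 + Polynomial.X * p) := by
    rw [hp]
    simp only [map_add, map_one, map_mul, Polynomial.aeval_X]
    noncomm_ring
  rw [this]
  refine Commute.isNilpotent_mul_right ?_ hX
  have := Polynomial.aeval_X (R := ℝ) X
  nth_rewrite 1 [← this]
  rw [Commute, SemiconjBy, ← map_mul, mul_comm, map_mul]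

/-- The equation reads `X (1 + X p(X)) = 0`, and the second factor is a unit, being unipotent. -/
theorem eq_zero_of_exp_eq_one {X : Matrix m m ℝ} (hX : IsNilpotent X)
    (h : NormedSpace.exp X = 1) : X = 0 := by
  obtain ⟨p, hp⟩ := exists_exp_eq hX
  rw [h] at hp
  have hc : Commute X (Polynomial.aeval X p) := by
    have := Polynomial.aeval_X (R := ℝ) X
    nth_rewrite 1 [← this]
    rw [Commute, SemiconjBy, ← map_mul, mul_comm, map_mul]
  have hu : IsUnit (1 + X * Polynomial.aeval X p) :=
    (hc.isNilpotent_mul_right hX).isUnit_one_add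
  have h0 : X * (1 + X * Polynomial.aeval X p) = 0 := by
    rw [mul_add, mul_one, ← mul_assoc, ← pow_two]
    rw [add_assoc] at hp
    exact (left_eq_add.1 hp)
  exact hu.mul_left_eq_zero.1 h0

/-- A polynomial logarithm by successive correction: if the error is `1 + z`, adding `z` to the
approximation changes it to `(1 + z) exp (-z)`, which is `1` up to a multiple of `z ^ 2`. -/
theorem exists_log_approx (N : Matrix m m ℝ) (hN : IsNilpotent N) (k : ℕ) :
    ∃ p r : Polynomial ℝ, IsNilpotent (Polynomial.aeval N p) ∧
      (1 + N) * NormedSpace.exp (-Polynomial.aeval N p) =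
        1 + N ^ (k + 1) * Polynomial.aeval N r := by
  induction k with
  | zero => exact ⟨0, 1, by simp, by simp [NormedSpace.exp_zero]⟩
  | succ k ih =>
    obtain ⟨p, r, hp, hr⟩ := ih
    set z : Polynomial ℝ := Polynomial.X ^ (k + 1) * r with hz
    have hzN : Polynomial.aeval N z = N ^ (k + 1) * Polynomial.aeval N r := by
      rw [hz, map_mul, map_pow, Polynomial.aeval_X]
    have hcomm : ∀ a b : Polynomial ℝ, Commute (Polynomial.aeval N a) (Polynomial.aeval N b) :=
      fun a b => by rw [Commute, SemiconjBy, ← map_mul, mul_comm, map_mul]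
    have hznil : IsNilpotent (Polynomial.aeval N z) := by
      have : z = Polynomial.X * (Polynomial.X ^ k * r) := by rw [hz, pow_succ']; ring
      rw [this, map_mul]
      refine (hcomm _ _).isNilpotent_mul_right ?_
      rwa [Polynomial.aeval_X]
    obtain ⟨q, hq⟩ := exists_exp_eq hznil.neg
    have hq' : Polynomial.aeval (-Polynomial.aeval N z) q = Polynomial.aeval N (q.comp (-z)) := by
      rw [Polynomial.aeval_comp, map_neg]
    -- From `(1 + z) (1 - z + z ^ 2 q) = 1 + z ^ 2 (-1 + q + z q)` and `z ^ 2 = N ^ (k + 2) (N ^ k r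
    -- ^ 2)`.
    refine ⟨p + z, Polynomial.X ^ k * r ^ 2 * (-1 + q.comp (-z) + z * q.comp (-z)), ?_, ?_⟩
    · rw [map_add]
      exact (hcomm p z).isNilpotent_add hp hznil
    · rw [map_add, neg_add, Matrix.exp_add_of_commute _ _ ((hcomm p z).neg_left.neg_right),
        ← mul_assoc, hr, hq, hq', ← hzN]
      have hXN : N = Polynomial.aeval N (Polynomial.X : Polynomial ℝ) :=
        (Polynomial.aeval_X N).symm
      have e1 : N ^ (k + 1 + 1) = Polynomial.aeval N (Polynomial.X ^ (k + 1 + 1) : Polynomial ℝ) := by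
        rw [map_pow, ← hXN]
      rw [e1, ← map_one (Polynomial.aeval (R := ℝ) N), ← map_neg, ← map_pow, ← map_mul, ← map_mul,
        ← map_add, ← map_add, ← map_add, ← map_add, ← map_mul]
      congr 1
      rw [hz]
      ring

theorem exists_log {N : Matrix m m ℝ} (hN : IsNilpotent N) :
    ∃ p : Polynomial ℝ, IsNilpotent (Polynomial.aeval N p) ∧
      NormedSpace.exp (Polynomial.aeval N p) = 1 + N := by
  obtain ⟨k, hk⟩ := id hN
  obtain ⟨p, r, hp, h⟩ := exists_log_approx N hN k
  refine ⟨p, hp, ?_⟩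
  rw [pow_succ, hk, zero_mul, zero_mul, add_zero] at h
  calc NormedSpace.exp (Polynomial.aeval N p)
      = ((1 + N) * NormedSpace.exp (-Polynomial.aeval N p)) *
          NormedSpace.exp (Polynomial.aeval N p) := by rw [h, one_mul]
    _ = 1 + N := by rw [mul_assoc, exp_neg_mul_exp, mul_one]

/-- Any nilpotent logarithm commutes with the exponential, hence with its polynomial logarithm. The
difference of the two is nilpotent with exponential `1`, so it is zero. -/
theorem exp_injOn_nilpotent {X Y : Matrix m m ℝ} (hX : IsNilpotent X) (hY : IsNilpotent Y)
    (h : NormedSpace.exp X = NormedSpace.exp Y) : X = Y := by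
  obtain ⟨p, hp, hL⟩ := exists_log (isNilpotent_exp_sub_one hX)
  rw [add_sub_cancel] at hL
  suffices key : ∀ Z : Matrix m m ℝ, IsNilpotent Z → NormedSpace.exp Z = NormedSpace.exp X →
      Z = Polynomial.aeval (NormedSpace.exp X - 1) p from (key X hX rfl).trans (key Y hY h.symm).symm
  intro Z hZ hZX
  have hc : Commute Z (Polynomial.aeval (NormedSpace.exp X - 1) p) := by
    have h1 : Commute Z (NormedSpace.exp X - 1) := by
      rw [← hZX]
      exact (Commute.refl Z).exp_right.sub_right (Commute.one_right Z)
    exact (Algebra.commute_of_mem_adjoin_singleton_of_commute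
      (Polynomial.aeval_mem_adjoin_singleton ℝ _) h1)
  have hnil : IsNilpotent (Z + -Polynomial.aeval (NormedSpace.exp X - 1) p) :=
    hc.neg_right.isNilpotent_add hZ hp.neg
  have := eq_zero_of_exp_eq_one hnil (by
    rw [Matrix.exp_add_of_commute _ _ hc.neg_right, hZX.trans hL.symm, exp_mul_exp_neg])
  rwa [← sub_eq_add_neg, sub_eq_zero] at this

end Exp

/-! ### Reality of unipotent elements -/

section Unipotent

variable {n : ℕ}

theorem exp_conj_group (g : SpGroup n) (A : Mat n) :
    NormedSpace.exp ((g : Mat n) * A * ((g⁻¹ : SpGroup n) : Mat n)) =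
      (g : Mat n) * NormedSpace.exp A * ((g⁻¹ : SpGroup n) : Mat n) :=
  Matrix.exp_units_conj ⟨(g : Mat n), ((g⁻¹ : SpGroup n) : Mat n), coe_mul_inv g, coe_inv_mul g⟩ A

theorem isNilpotent_ad (g : SpGroup n) {X : SpAlg n} (hX : IsNilpotent (X : Mat n)) :
    IsNilpotent (Ad g X : Mat n) := by
  obtain ⟨k, hk⟩ := hX
  refine ⟨k, ?_⟩
  have : ∀ k, (Ad g X : Mat n) ^ k =
      (g : Mat n) * (X : Mat n) ^ k * ((g⁻¹ : SpGroup n) : Mat n) := by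
    intro k
    induction k with
    | zero => rw [pow_zero, pow_zero, Matrix.mul_one, coe_mul_inv]
    | succ k ih =>
      rw [pow_succ, ih, pow_succ]
      change (g : Mat n) * (X : Mat n) ^ k * ((g⁻¹ : SpGroup n) : Mat n) *
        ((g : Mat n) * (X : Mat n) * ((g⁻¹ : SpGroup n) : Mat n)) = _
      calc _ = (g : Mat n) * (X : Mat n) ^ k * (((g⁻¹ : SpGroup n) : Mat n) * (g : Mat n)) *
            (X : Mat n) * ((g⁻¹ : SpGroup n) : Mat n) := by simp only [Matrix.mul_assoc]
        _ = _ := by rw [coe_inv_mul, Matrix.mul_one]; simp only [Matrix.mul_assoc]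
  rw [this, hk, Matrix.mul_zero, Matrix.zero_mul]

/-- The symplectic relation says that the transpose of `u` is `J u⁻¹ J⁻¹`. Both sides are
exponentials of nilpotent matrices, `Aᵀ` and `J (-A) J⁻¹`, which therefore coincide. -/
theorem mem_sp_of_exp {A : Mat n} (hA : IsNilpotent A) {u : SpGroup n}
    (h : NormedSpace.exp A = (u : Mat n)) : A ∈ LieAlgebra.Symplectic.sp (Fin n) ℝ := by
  have hJ : J (Fin n) ℝ * -J (Fin n) ℝ = 1 := by rw [Matrix.mul_neg, Matrix.J_squared, neg_neg]
  have hJ' : -J (Fin n) ℝ * J (Fin n) ℝ = 1 := by rw [Matrix.neg_mul, Matrix.J_squared, neg_neg]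
  let U : (Mat n)ˣ := ⟨J (Fin n) ℝ, -J (Fin n) ℝ, hJ, hJ'⟩
  have e1 : NormedSpace.exp Aᵀ = (u : Mat n)ᵀ := by rw [Matrix.exp_transpose, h]
  have e2 : NormedSpace.exp (J (Fin n) ℝ * -A * -J (Fin n) ℝ) =
      J (Fin n) ℝ * NormedSpace.exp (-A) * -J (Fin n) ℝ := Matrix.exp_units_conj U (-A)
  have hu := SymplecticGroup.mem_iff'.1 u.2
  have e3 : (u : Mat n) * NormedSpace.exp (-A) = 1 := by rw [← h, exp_mul_exp_neg]
  have e4 : (u : Mat n)ᵀ = J (Fin n) ℝ * NormedSpace.exp (-A) * -J (Fin n) ℝ := by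
    calc (u : Mat n)ᵀ = (u : Mat n)ᵀ * (J (Fin n) ℝ * ((u : Mat n) * NormedSpace.exp (-A)) *
          -J (Fin n) ℝ) := by rw [e3, Matrix.mul_one, hJ, Matrix.mul_one]
      _ = ((u : Mat n)ᵀ * J (Fin n) ℝ * (u : Mat n)) * NormedSpace.exp (-A) * -J (Fin n) ℝ := by
          simp only [Matrix.mul_assoc]
      _ = _ := by rw [hu]
  have hnil : IsNilpotent (J (Fin n) ℝ * -A * -J (Fin n) ℝ) := by
    obtain ⟨k, hk⟩ := hA.neg
    refine ⟨k, ?_⟩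
    have := Units.conj_pow U (-A) k
    rw [hk, Matrix.mul_zero, Matrix.zero_mul] at this
    exact this
  have hnilT : IsNilpotent Aᵀ := by
    obtain ⟨k, hk⟩ := hA
    exact ⟨k, by rw [← Matrix.transpose_pow, hk, Matrix.transpose_zero]⟩
  have key := exp_injOn_nilpotent hnilT hnil (by rw [e1, e2, e4])
  rw [mem_sp_iff, key, Matrix.mul_assoc, hJ', Matrix.mul_one, Matrix.mul_neg]

theorem existsUnique_log (u : SpGroup n) (hu : IsNilpotent ((u : Mat n) - 1)) :
    ∃! X : SpAlg n, IsNilpotent (X : Mat n) ∧ NormedSpace.exp (X : Mat n) = (u : Mat n) := by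
  obtain ⟨p, hp, h⟩ := exists_log hu
  rw [add_sub_cancel] at h
  refine ⟨⟨_, mem_sp_of_exp hp h⟩, ⟨hp, h⟩, fun Z hZ => Subtype.ext ?_⟩
  exact exp_injOn_nilpotent hZ.1 hp (hZ.2.trans h.symm)

theorem coe_inv_eq_exp_neg {u : SpGroup n} {A : Mat n} (h : NormedSpace.exp A = (u : Mat n)) :
    ((u⁻¹ : SpGroup n) : Mat n) = NormedSpace.exp (-A) := by
  calc ((u⁻¹ : SpGroup n) : Mat n) =
      ((u⁻¹ : SpGroup n) : Mat n) * (NormedSpace.exp A * NormedSpace.exp (-A)) := by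
        rw [exp_mul_exp_neg, Matrix.mul_one]
    _ = NormedSpace.exp (-A) := by rw [h, ← Matrix.mul_assoc, coe_inv_mul, Matrix.one_mul]

theorem conj_eq_inv_iff {X : SpAlg n} (hX : IsNilpotent (X : Mat n)) {u : SpGroup n}
    (h : NormedSpace.exp (X : Mat n) = (u : Mat n)) (g : SpGroup n) :
    g * u * g⁻¹ = u⁻¹ ↔ -X = Ad g X := by
  have e : ((g * u * g⁻¹ : SpGroup n) : Mat n) = NormedSpace.exp (Ad g X : Mat n) := by
    rw [Submonoid.coe_mul, Submonoid.coe_mul, ← h]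
    exact (exp_conj_group g X).symm
  rw [← Subtype.coe_inj, e, coe_inv_eq_exp_neg h]
  constructor
  · intro h'
    exact Subtype.ext (exp_injOn_nilpotent (isNilpotent_ad g hX) hX.neg h').symm
  · intro h'
    rw [← h']
    rfl

theorem tfae_real_unipotent {X : SpAlg n} (hX : IsNilpotent (X : Mat n)) {u : SpGroup n}
    (h : NormedSpace.exp (X : Mat n) = (u : Mat n)) {D : SignedYoungDiagram (2 * n)}
    (hD : IsDiagramOf X D) :
    [IsRealElement u, IsStronglyRealElement u, D.IsBalanced].TFAE := by
  tfae_have 1 → 3 := by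
    rintro ⟨g, hg⟩
    exact isBalanced_of_isAdReal hD ⟨g, ((conj_eq_inv_iff hX h g).1 hg).symm⟩
  tfae_have 3 → 2 := by
    intro hb
    obtain ⟨τ, hτ, hτX⟩ := isStronglyAdReal_of_isBalanced hD hb
    have hτu := (conj_eq_inv_iff hX h τ).2 hτX
    have hττ : τ⁻¹ = τ := by
      rw [inv_eq_iff_mul_eq_one, ← pow_two, hτ]
    rw [hττ] at hτu
    -- Since `τ u τ = u⁻¹`, the product `u τ` also has square one.
    refine ⟨u * τ, τ, ?_, hτ, ?_⟩
    · calc (u * τ) ^ 2 = u * (τ * u * τ) := by rw [pow_two]; simp only [mul_assoc]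
        _ = 1 := by rw [hτu, mul_inv_cancel]
    · rw [mul_assoc, ← pow_two, hτ, mul_one]
  tfae_have 2 → 1 := by
    rintro ⟨a, b, ha, hb, rfl⟩
    have ha' : a⁻¹ = a := by rw [inv_eq_iff_mul_eq_one, ← pow_two, ha]
    have hb' : b⁻¹ = b := by rw [inv_eq_iff_mul_eq_one, ← pow_two, hb]
    refine ⟨a, ?_⟩
    rw [_root_.mul_inv_rev, ha', hb', ← mul_assoc, ← pow_two, ha, one_mul]
  tfae_finish

end Unipotent

end SpReal

end

theorem mainTheorem6 (n : ℕ) :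
    (∀ X : SpReal.SpAlg n, IsNilpotent (X : SpReal.Mat n) →
      (∃! D : SpReal.SignedYoungDiagram (2 * n), SpReal.IsDiagramOf X D) ∧
      (∀ D : SpReal.SignedYoungDiagram (2 * n), SpReal.IsDiagramOf X D →
        [SpReal.IsAdReal X, SpReal.IsStronglyAdReal X, D.IsBalanced].TFAE)) ∧
    (∀ u : SpReal.SpGroup n, IsNilpotent ((u : SpReal.Mat n) - 1) →
      (∃! X : SpReal.SpAlg n, IsNilpotent (X : SpReal.Mat n) ∧
        NormedSpace.exp (X : SpReal.Mat n) = (u : SpReal.Mat n)) ∧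
      (∀ X : SpReal.SpAlg n, IsNilpotent (X : SpReal.Mat n) →
        NormedSpace.exp (X : SpReal.Mat n) = (u : SpReal.Mat n) →
        ∀ D : SpReal.SignedYoungDiagram (2 * n), SpReal.IsDiagramOf X D →
          [SpReal.IsRealElement u, SpReal.IsStronglyRealElement u, D.IsBalanced].TFAE)) := by
  refine ⟨fun X hX => ⟨?_, fun D hD => SpReal.tfae_real hD⟩, fun u hu =>
    ⟨SpReal.existsUnique_log u hu, fun X hX h D hD => SpReal.tfae_real_unipotent hX h hD⟩⟩
  obtain ⟨D, hD⟩ := SpReal.exists_isDiagramOf X hX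
  exact ⟨D, hD, fun D' hD' => SpReal.isDiagramOf_unique hD' hD⟩
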